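/- Let $1\le k\le n$ be integers and let $V$ be a set of $n$ vertices, each holding an opinion in $[k]=\{1,\dots,k\}$. In each synchronous round of \emph{3-Majority}, every vertex $v$ independently picks $w_1,w_2,w_3\in V$ independently and uniformly at random (with replacement) and adopts the current opinion of $w_1$ if $w_1$ and $w_2$ hold the same opinion, and the current opinion of $w_3$ otherwise. In each round of \emph{2-Choices}, every vertex $v$ independently picks $w_1,w_2\in V$ independently and uniformly at random (with replacement), adopts their current opinion if $w_1$ and $w_2$ hold the same opinion, and keeps its own opinion otherwise. Let $\mathsf{opn}_t\in[k]^V$ be the resulting Markov chain started from a fixed initial configuration $\mathsf{opn}_0$, let $\alpha_t(i)$ be the fraction of vertices holding opinion $i$ after round $t$, and let $\gamma_t=\sum_{i\in[k]}\alpha_t(i)^2$. \textbf{3-Majority.} There are universal constants $C_0,A,K,c>0$ such that for every $C\ge C_0$, all $1\le k\le n$, and every initial configuration with $$\gamma_0\ge \frac{C\log n}{\sqrt n}\qquad\text{and}\qquad \alpha_0(1)-\alpha_0(j)\ge C\sqrt{\frac{\log n}{n}}\quad\text{for all } j\ne 1,$$ there is a (deterministic) integer $T$ with $0\le T\le A\,\frac{\log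 n}{\gamma_0}$ such that 3-Majority satisfies $\Pr[\alpha_T(1)=1]\ge 1-Kn^{-c}$. \textbf{2-Choices.} There are universal constants $C_0,A,K,c>0$ such that for every $C\ge C_0$, all $1\le k\le n$, and every initial configuration with $$\gamma_0\ge \frac{C(\log n)^2}{n}\qquad\text{and}\qquad \alpha_0(1)-\alpha_0(j)\ge C\sqrt{\frac{\alpha_0(1)\log n}{n}}\quad\text{for all } j\ne 1,$$ there is a (deterministic) integer $T$ with $0\le T\le A\,\frac{\log n}{\gamma_0}$ such that 2-Choices satisfies $\Pr[\alpha_T(1)=1]\ge 1-Kn^{-c}$. -/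

import Mathlib

open MeasureTheory

noncomputable section

/-- `X` is a discrete-time Markov chain on the state space `S` with one-step transition
probabilities `step` and initial state `s₀`, defined on the probability space `(Ω, μ)`:
conditionally on `X 0 = s 0, …, X t = s t`, the state `X (t + 1)` has law `step (s t)`. -/
structure IsMarkovChain {S Ω : Type*} [MeasurableSpace S] [MeasurableSpace Ω]
    (step : S → PMF S) (s₀ : S) (μ : Measure Ω) (X : ℕ → Ω → S) : Prop where
  measurable : ∀ t, Measurable (X t)
  init : ∀ᵐ ω ∂μ, X 0 ω = s₀
  markov : ∀ (t : ℕ) (s : ℕ → S),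
    μ {ω | ∀ i ≤ t + 1, X i ω = s i} = μ {ω | ∀ i ≤ t, X i ω = s i} * step (s t) (s (t + 1))

/-- One synchronous round of 3-Majority from the configuration `σ`: every vertex `v` selects
`w v 0, w v 1, w v 2` independently and uniformly at random, with replacement (that is, the
table `w` of all selections is uniform), adopts the opinion of the first two selected vertices
if these agree, and otherwise the opinion of the third one. -/
def threeMajorityStep {V : Type*} [Fintype V] [DecidableEq V] [Nonempty V] {k : ℕ}
    (σ : V → Fin k) : PMF (V → Fin k) :=
  (PMF.uniformOfFintype (V → Fin 3 → V)).map
    fun w v => if σ (w v 0) = σ (w v 1) then σ (w v 0) else σ (w v 2)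

/-- One synchronous round of 2-Choices from the configuration `σ`: every vertex `v` selects
`w v 0, w v 1` independently and uniformly at random, with replacement, adopts their opinion
if they agree, and otherwise keeps its own opinion. -/
def twoChoicesStep {V : Type*} [Fintype V] [DecidableEq V] [Nonempty V] {k : ℕ}
    (σ : V → Fin k) : PMF (V → Fin k) :=
  (PMF.uniformOfFintype (V → Fin 2 → V)).map
    fun w v => if σ (w v 0) = σ (w v 1) then σ (w v 0) else σ v

/-- The fraction of vertices that hold opinion `i` in the configuration `σ`. -/
def opinionFraction {V : Type*} [Fintype V] {k : ℕ} (σ : V → Fin k) (i : Fin k) : ℝ :=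
  ((Finset.univ.filter fun v => σ v = i).card : ℝ) / (Fintype.card V : ℝ)

/-- The squared `ℓ²`-norm of the vector of opinion fractions of the configuration `σ`. -/
def opinionNormSq {V : Type*} [Fintype V] {k : ℕ} (σ : V → Fin k) : ℝ :=
  ∑ i : Fin k, opinionFraction σ i ^ 2

end

/-! Write `x₀` for the initial fraction of opinion 1, `L` for `log n` and `γ` for the squared norm.
In both dynamics the vertices update independently, and opinion `i` has expected fraction `α(i) (1 +
α(i) - γ)` after a round, so a larger opinion grows by a larger factor. The dynamics differ only in
their noise, measured by a level `ν`: `2 / (n x₀)` for 3-Majority and `1 / n` for 2-Choices.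
`DriftBounds` records the shared drift and the noise; both pairs of hypotheses become `10^7 ν L² ≤
x₀` and a lead of at least `√(10^7 ν x₀ L)`, and `DriftBounds.consensus` treats both cases at once.

That argument runs for `2N` rounds, `N` of order `L / x₀`. The chain is followed while it stays in
`dominating V i₀ x₀ (s t)`: the leader keeps half of its initial fraction and beats each rival by
the factor `1 + s t`, where `s t` grows geometrically and reaches 1 by time `N`. Two exponential
functions, of the leader's fraction (`DriftBounds.expect_plurality_le`) and of its weighted lead
over one rival (`DriftBounds.expect_bias_le`), are supermartingales on these sets up to small
errors, so leaving them is unlikely. From time `N` on every rival is at most half the leader, and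
the expectation of `1 / α(1) - 1` contracts by `1 - x₀ / 16` per round
(`DriftBounds.expect_inverse_le`). Away from consensus this quantity is at least `1 / n`, so
Markov's inequality finishes. Since `γ₀ ≤ x₀`, the time is also of order `L / γ₀`.

Measures killed on leaving the good sets take the place of stopping times. -/

/-! ### Finite chains killed on leaving time-dependent sets. -/

section Chain

variable {S : Type*} [Fintype S]

/-- The expectation of a real function under a probability mass function on a finite type. -/
noncomputable def PMF.expect (p : PMF S) (f : S → ℝ) : ℝ := ∑ s, (p s).toReal * f s

theorem PMF.sum_toReal (p : PMF S) : ∑ s, (p s).toReal = 1 := by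
  rw [← ENNReal.toReal_sum fun s _ => p.apply_ne_top s]
  have := p.tsum_coe
  rw [tsum_fintype] at this
  simp [this]

theorem PMF.expect_mono (p : PMF S) {f g : S → ℝ} (h : ∀ s, f s ≤ g s) :
    p.expect f ≤ p.expect g :=
  Finset.sum_le_sum fun s _ => mul_le_mul_of_nonneg_left (h s) ENNReal.toReal_nonneg

theorem PMF.expect_const (p : PMF S) (c : ℝ) : p.expect (fun _ => c) = c := by
  rw [PMF.expect, ← Finset.sum_mul, p.sum_toReal, one_mul]

theorem PMF.expect_add (p : PMF S) (f g : S → ℝ) :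
    p.expect (fun s => f s + g s) = p.expect f + p.expect g := by
  simp [PMF.expect, mul_add, Finset.sum_add_distrib]

theorem PMF.expect_const_mul (p : PMF S) (c : ℝ) (f : S → ℝ) :
    p.expect (fun s => c * f s) = c * p.expect f := by
  simp only [PMF.expect, Finset.mul_sum]
  exact Finset.sum_congr rfl fun s _ => by ring

open Classical in
/-- The mass at time `t` of the chain started from `s₀` that is removed as soon as it is found
outside `G i` at a time `i < t`. -/
noncomputable def killedMass (step : S → PMF S) (s₀ : S) (G : ℕ → Set S) : ℕ → S → ℝ
  | 0, s => if s = s₀ then 1 else 0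
  | t + 1, s' => ∑ s, if s ∈ G t then killedMass step s₀ G t s * (step s s').toReal else 0

variable (step : S → PMF S) (s₀ : S) (G : ℕ → Set S)

theorem killedMass_nonneg (t : ℕ) (s : S) : 0 ≤ killedMass step s₀ G t s := by
  induction t generalizing s with
  | zero => rw [killedMass]; split_ifs <;> norm_num
  | succ t ih =>
    rw [killedMass]
    refine Finset.sum_nonneg fun a _ => ?_
    split_ifs
    · exact mul_nonneg (ih a) ENNReal.toReal_nonneg
    · exact le_rfl

/-- The integral of `f` against the killed mass at time `t`. -/
noncomputable def killedSum (t : ℕ) (f : S → ℝ) : ℝ := ∑ s, killedMass step s₀ G t s * f s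

theorem killedSum_zero (f : S → ℝ) : killedSum step s₀ G 0 f = f s₀ := by
  classical
  simp [killedSum, killedMass]

open Classical in
theorem killedSum_succ (t : ℕ) (f : S → ℝ) :
    killedSum step s₀ G (t + 1) f =
      killedSum step s₀ G t fun s => if s ∈ G t then (step s).expect f else 0 := by
  simp only [killedSum, killedMass, PMF.expect, Finset.sum_mul]
  rw [Finset.sum_comm]
  refine Finset.sum_congr rfl fun s _ => ?_
  split_ifs
  · rw [Finset.mul_sum]
    exact Finset.sum_congr rfl fun s' _ => by ring
  · simp

theorem killedSum_mono (t : ℕ) {f g : S → ℝ} (h : ∀ s, f s ≤ g s) :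
    killedSum step s₀ G t f ≤ killedSum step s₀ G t g :=
  Finset.sum_le_sum fun s _ => mul_le_mul_of_nonneg_left (h s) (killedMass_nonneg step s₀ G t s)

theorem killedSum_add (t : ℕ) (f g : S → ℝ) :
    killedSum step s₀ G t (fun s => f s + g s) =
      killedSum step s₀ G t f + killedSum step s₀ G t g := by
  simp [killedSum, mul_add, Finset.sum_add_distrib]

theorem killedSum_const_mul (t : ℕ) (c : ℝ) (f : S → ℝ) :
    killedSum step s₀ G t (fun s => c * f s) = c * killedSum step s₀ G t f := by
  simp only [killedSum, Finset.mul_sum]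
  exact Finset.sum_congr rfl fun s _ => by ring

theorem killedSum_sum {ι : Type*} (J : Finset ι) (t : ℕ) (f : ι → S → ℝ) :
    killedSum step s₀ G t (fun s => ∑ j ∈ J, f j s) = ∑ j ∈ J, killedSum step s₀ G t (f j) := by
  simp only [killedSum, Finset.mul_sum]
  exact Finset.sum_comm

theorem killedSum_one_le (t : ℕ) : killedSum step s₀ G t (fun _ => 1) ≤ 1 := by
  classical
  induction t with
  | zero => rw [killedSum_zero]
  | succ t ih =>
    rw [killedSum_succ]
    refine (killedSum_mono _ _ _ _ fun s => ?_).trans ih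
    rw [PMF.expect_const]
    split_ifs <;> norm_num

theorem killedSum_const_le (t : ℕ) {c : ℝ} (hc : 0 ≤ c) :
    killedSum step s₀ G t (fun _ => c) ≤ c := by
  have h := killedSum_const_mul step s₀ G t c fun _ => 1
  simp only [mul_one] at h
  rw [h]
  exact mul_le_of_le_one_right hc (killedSum_one_le step s₀ G t)

/-- A one-step drift inequality on the set `G t` passes to the killed sums. -/
theorem killedSum_succ_le (t : ℕ) {f g : S → ℝ} {r ε : ℝ} (hr : 0 ≤ r) (hε : 0 ≤ ε)
    (hf : ∀ s, 0 ≤ f s) (h : ∀ s ∈ G t, (step s).expect g ≤ r * f s + ε) :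
    killedSum step s₀ G (t + 1) g ≤ r * killedSum step s₀ G t f + ε := by
  classical
  rw [killedSum_succ]
  calc _ ≤ killedSum step s₀ G t fun s => r * f s + ε := by
        refine killedSum_mono _ _ _ _ fun s => ?_
        split_ifs with hs
        · exact h s hs
        · exact add_nonneg (mul_nonneg hr (hf s)) hε
    _ ≤ _ := by
        rw [killedSum_add, killedSum_const_mul]
        exact add_le_add le_rfl (killedSum_const_le step s₀ G t hε)

/-- Iterated drift inequality. -/
theorem killedSum_le_of_drift (f : ℕ → S → ℝ) {r ε : ℝ} (hr : 1 ≤ r) (hε : 0 ≤ ε)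
    (hf : ∀ t s, 0 ≤ f t s)
    (h : ∀ t, ∀ s ∈ G t, (step s).expect (f (t + 1)) ≤ r * f t s + ε) (t : ℕ) :
    killedSum step s₀ G t (f t) ≤ r ^ t * (f 0 s₀ + t * ε) := by
  induction t with
  | zero => simp [killedSum_zero]
  | succ t ih =>
    refine (killedSum_succ_le step s₀ G t (zero_le_one.trans hr) hε (hf t) (h t)).trans ?_
    have h1 : r * killedSum step s₀ G t (f t) ≤ r * (r ^ t * (f 0 s₀ + t * ε)) :=
      mul_le_mul_of_nonneg_left ih (by linarith)
    have h2 : ε ≤ r ^ (t + 1) * ε := le_mul_of_one_le_left hε (one_le_pow₀ hr)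
    push_cast
    calc _ ≤ r * (r ^ t * (f 0 s₀ + t * ε)) + r ^ (t + 1) * ε := add_le_add h1 h2
      _ = _ := by ring

/-- Iterated contraction from time `N` on. -/
theorem killedSum_le_of_contraction (f : S → ℝ) {r : ℝ} (hr : 0 ≤ r) (hf : ∀ s, 0 ≤ f s) (N : ℕ)
    (h : ∀ t, N ≤ t → ∀ s ∈ G t, (step s).expect f ≤ r * f s) (t : ℕ) :
    killedSum step s₀ G (N + t) f ≤ r ^ t * killedSum step s₀ G N f := by
  induction t with
  | zero => simp
  | succ t ih =>
    refine (killedSum_succ_le step s₀ G (N + t) (f := f) hr le_rfl hf fun s hs => ?_).trans ?_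
    · rw [add_zero]; exact h _ (Nat.le_add_right _ _) s hs
    · rw [add_zero, pow_succ', mul_assoc]
      exact mul_le_mul_of_nonneg_left ih hr

open Classical in
/-- The killed mass loses at each step exactly what lies outside the good set. -/
theorem killedSum_one_eq (t : ℕ) :
    killedSum step s₀ G t (fun _ => 1) =
      1 - ∑ i ∈ Finset.range t, killedSum step s₀ G i fun s => if s ∈ G i then 0 else 1 := by
  induction t with
  | zero => simp [killedSum_zero]
  | succ t ih =>
    rw [Finset.sum_range_succ, ← sub_sub, ← ih, killedSum_succ, eq_sub_iff_add_eq, ← killedSum_add]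
    congr 1
    funext s
    rw [PMF.expect_const]
    split_ifs <;> norm_num

/-! ### Comparison of the killed mass with the law of a Markov chain. -/

variable {Ω : Type*} [MeasurableSpace S] [MeasurableSingletonClass S] [MeasurableSpace Ω]
  {μ : Measure Ω} {X : ℕ → Ω → S} {step s₀}

omit [Fintype S] in
theorem IsMarkovChain.measurableSet_window (h : IsMarkovChain step s₀ μ X) (m t : ℕ) (s : ℕ → S) :
    MeasurableSet {ω | ∀ i, m ≤ i → i ≤ t → X i ω = s i} := by
  have : {ω | ∀ i, m ≤ i → i ≤ t → X i ω = s i} =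
      ⋂ i, ⋂ (_ : m ≤ i), ⋂ (_ : i ≤ t), X i ⁻¹' {s i} := by
    ext ω; simp
  rw [this]
  exact .iInter fun i => .iInter fun _ => .iInter fun _ => h.measurable i (measurableSet_singleton _)

theorem IsMarkovChain.measure_window_succ (h : IsMarkovChain step s₀ μ X) {m t : ℕ} (hm : m ≤ t)
    (s : ℕ → S) :
    μ {ω | ∀ i, m + 1 ≤ i → i ≤ t → X i ω = s i} =
      ∑ a, μ {ω | ∀ i, m ≤ i → i ≤ t → X i ω = Function.update s m a i} := by
  rw [← measure_biUnion_finset]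
  · congr 1
    ext ω
    simp only [Set.mem_ofPred_eq, Finset.mem_univ, Set.iUnion_true, Set.mem_iUnion]
    constructor
    · intro hω
      refine ⟨X m ω, fun i hi hit => ?_⟩
      rcases hi.eq_or_lt with rfl | hlt
      · simp
      · rw [Function.update_of_ne (by omega)]
        exact hω i hlt hit
    · rintro ⟨a, ha⟩ i hi hit
      have := ha i (by omega) hit
      rwa [Function.update_of_ne (by omega)] at this
  · intro a _ b _ hab
    refine Set.disjoint_left.2 fun ω ha hb => hab ?_
    have h1 := ha m le_rfl hm
    have h2 := hb m le_rfl hm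
    simp only [Function.update_self] at h1 h2
    exact h1.symm.trans h2
  · intro a _
    exact h.measurableSet_window m t _

/-- The field `markov` conditions on the whole past from time 0. Summing out the earliest
coordinate, one at a time, forgets that past. -/
theorem IsMarkovChain.measure_window (h : IsMarkovChain step s₀ μ X) {m t : ℕ} (hm : m ≤ t)
    (s : ℕ → S) :
    μ {ω | ∀ i, m ≤ i → i ≤ t + 1 → X i ω = s i} =
      μ {ω | ∀ i, m ≤ i → i ≤ t → X i ω = s i} * step (s t) (s (t + 1)) := by
  induction m generalizing s with
  | zero => simpa using h.markov t s
  | succ m ih =>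
    rw [h.measure_window_succ (by omega), h.measure_window_succ (by omega), Finset.sum_mul]
    refine Finset.sum_congr rfl fun a _ => ?_
    rw [ih (by omega), Function.update_of_ne (by omega), Function.update_of_ne (by omega)]

theorem IsMarkovChain.measure_succ (h : IsMarkovChain step s₀ μ X) (t : ℕ) (b : S) :
    μ {ω | X (t + 1) ω = b} = ∑ a, μ {ω | X t ω = a} * step a b := by
  have h1 := h.measure_window_succ (m := t) (t := t + 1) (by omega) (fun _ => b)
  have e1 : {ω | ∀ i, t + 1 ≤ i → i ≤ t + 1 → X i ω = b} = {ω | X (t + 1) ω = b} := by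
    ext ω
    exact ⟨fun hω => hω _ le_rfl le_rfl, fun hω i hi hi' => by rwa [le_antisymm hi' hi]⟩
  rw [e1] at h1
  rw [h1]
  refine Finset.sum_congr rfl fun a _ => ?_
  rw [h.measure_window le_rfl, Function.update_self, Function.update_of_ne (by omega)]
  congr 2
  ext ω
  refine ⟨fun hω => by simpa using hω t le_rfl le_rfl, fun hω i hi hi' => ?_⟩
  obtain rfl := le_antisymm hi' hi
  simpa using hω

variable [IsProbabilityMeasure μ]

theorem IsMarkovChain.killedMass_le (h : IsMarkovChain step s₀ μ X) (t : ℕ) (s : S) :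
    killedMass step s₀ G t s ≤ μ.real {ω | X t ω = s} := by
  induction t generalizing s with
  | zero =>
    rw [killedMass]
    split_ifs with hs
    · have : μ {ω | X 0 ω = s} = 1 := by
        have hm : MeasurableSet {ω | X 0 ω = s₀} := h.measurable 0 (measurableSet_singleton s₀)
        rw [hs, ← prob_compl_eq_zero_iff hm]
        exact h.init
      simp [measureReal_def, this]
    · exact measureReal_nonneg
  | succ t ih =>
    rw [killedMass, measureReal_def, h.measure_succ, ENNReal.toReal_sum
      fun a _ => ENNReal.mul_ne_top (measure_ne_top _ _) ((step a).apply_ne_top s)]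
    refine Finset.sum_le_sum fun a _ => ?_
    rw [ENNReal.toReal_mul]
    split_ifs
    · exact mul_le_mul_of_nonneg_right (ih a) ENNReal.toReal_nonneg
    · positivity

-- A union bound: mass is lost only by being found outside some `G i` before time `T`, and what
-- survives lies below the true law at time `T`.
open Classical in
theorem IsMarkovChain.one_sub_le (h : IsMarkovChain step s₀ μ X) (T : ℕ) (B : Set S) :
    1 - (∑ i ∈ Finset.range T, killedSum step s₀ G i fun s => if s ∈ G i then 0 else 1)
      - killedSum step s₀ G T (fun s => if s ∈ B then 0 else 1) ≤ μ.real {ω | X T ω ∈ B} := by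
  rw [← killedSum_one_eq, sub_le_iff_le_add]
  have e : {ω | X T ω ∈ B} = ⋃ s ∈ Finset.univ.filter (· ∈ B), {ω | X T ω = s} := by
    ext ω; simp
  rw [e, measureReal_biUnion_finset]
  · calc _ = killedSum step s₀ G T (fun s => (if s ∈ B then 1 else 0) + if s ∈ B then 0 else 1) := by
          congr 1; funext s; split_ifs <;> norm_num
      _ = killedSum step s₀ G T (fun s => if s ∈ B then 1 else 0) + _ := killedSum_add ..
      _ ≤ _ := by
          refine add_le_add ?_ le_rfl
          rw [killedSum, Finset.sum_filter]
          refine Finset.sum_le_sum fun s _ => ?_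
          split_ifs
          · rw [mul_one]; exact h.killedMass_le G T s
          · simp
  · intro a _ b _ hab
    exact Set.disjoint_left.2 fun ω ha hb => hab (ha.symm.trans hb)
  · intro a _
    exact h.measurable T (measurableSet_singleton a)

end Chain

/-! ### Real inequalities behind the one-round estimates. -/

section Real

/-- The drift of a rival's deficit beats the noise, or else the deficit is already large. -/
theorem pluralityBias_exponent_le {x x₀ y γ s s' d ν l : ℝ} (hx₀ : 0 < x₀) (hx : x₀ / 2 ≤ x)
    (hx1 : x ≤ 1) (hγ0 : 0 ≤ γ) (hγ : γ ≤ x) (hL : (1 + s) * y ≤ x) (hss' : s ≤ s')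
    (hs'1 : s' ≤ 1) (hs' : s' ≤ (1 + x₀ / 32) * s) (hs : d / (2 * x₀) ≤ s) (hd : 0 < d)
    (hdx : d ≤ x₀) (hν : 0 < ν) (hl : l = d / (1280 * ν * x₀)) (hy : 0 ≤ y) :
    -(l * (x * (1 + x - γ) - (1 + s') * (y * (1 + y - γ)))) + 20 * ν * l ^ 2 * x ^ 2
        ≤ -(l * (x - (1 + s) * y)) ∨
      -(l * (x * (1 + x - γ) - (1 + s') * (y * (1 + y - γ)))) + 20 * ν * l ^ 2 * x ^ 2
        ≤ -(l * (x₀ / 8)) := by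
  have hxpos : 0 < x := by linarith
  have hlpos : 0 < l := by rw [hl]; positivity
  have hspos : 0 < s := lt_of_lt_of_le (by positivity) hs
  -- The choice of `l` makes the noise a small multiple of the drift: `20 ν l = d / (64 x₀)`.
  have hnoise : 20 * ν * l ^ 2 * x ^ 2 = l * (x ^ 2 * (d / (64 * x₀))) := by
    rw [hl]; field_simp; norm_num
  rw [hnoise]
  set e := x - γ with he
  have he0 : 0 ≤ e := by linarith
  have he1 : e ≤ 1 := by linarith
  have hmean : x * (1 + x - γ) - (1 + s') * (y * (1 + y - γ)) =
      (x - (1 + s') * y) * (1 + e) + (1 + s') * (y * (x - y)) := by rw [he]; ring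
  rw [hmean]
  have hδ : s * y ≤ x - y := by linarith
  have hδ0 : 0 ≤ x - y := le_trans (by positivity) hδ
  -- A rival above `x / 4` yields the extra drift `y (x - y)`; half of it pays for raising `s` to
  -- `s'`, the other half for the noise. A smaller rival leaves a gap of at least `x / 2`, far more
  -- than the noise.
  rcases le_or_gt (x / 4) y with hxy | hxy
  · left
    have h1 : (x - (1 + s) * y) - 2 * ((s' - s) * y) ≤ (x - (1 + s') * y) * (1 + e) := by
      have a1 : 0 ≤ (x - (1 + s) * y) * e := mul_nonneg (by linarith) he0
      have a2 : 0 ≤ (s' - s) * y * (1 - e) := mul_nonneg (mul_nonneg (by linarith) hy) (by linarith)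
      nlinarith
    have h2 : y * (x - y) ≤ (1 + s') * (y * (x - y)) :=
      le_mul_of_one_le_left (mul_nonneg hy hδ0) (by linarith)
    have h3 : 2 * ((s' - s) * y) ≤ y * (x - y) / 2 := by
      have b1 : s' - s ≤ x₀ / 32 * s := by linarith
      have b2 : x₀ * s ≤ 8 * (s * y) := by nlinarith
      have b3 : s' - s ≤ (x - y) / 4 := by linarith
      nlinarith
    have h4 : x ^ 2 * (d / (64 * x₀)) ≤ y * (x - y) / 2 := by
      have c1 : d / (64 * x₀) = d / (2 * x₀) / 32 := by field_simp; norm_num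
      have c2 : x / 4 * s ≤ x - y := le_trans (by nlinarith) hδ
      have c3 : x / 4 * (x / 4 * s) ≤ y * (x - y) :=
        mul_le_mul hxy c2 (by positivity) hy
      rw [c1]
      have c4 := mul_le_mul_of_nonneg_left hs (sq_nonneg x)
      linarith
    have h5 := mul_le_mul_of_nonneg_left
      (show (x - (1 + s) * y) + x ^ 2 * (d / (64 * x₀)) ≤
        (x - (1 + s') * y) * (1 + e) + (1 + s') * (y * (x - y)) by linarith) hlpos.le
    linarith
  · right
    have h1 : x / 2 ≤ x - (1 + s') * y := by nlinarith
    have h2 : x / 2 ≤ (x - (1 + s') * y) * (1 + e) := by nlinarith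
    have h3 : 0 ≤ (1 + s') * (y * (x - y)) := mul_nonneg (by linarith) (mul_nonneg hy hδ0)
    have h4 : x ^ 2 * (d / (64 * x₀)) ≤ x / 64 := by
      have c1 : d / (64 * x₀) ≤ 1 / 64 := by
        rw [div_le_div_iff₀ (by positivity) (by norm_num)]; linarith
      calc x ^ 2 * (d / (64 * x₀)) ≤ x ^ 2 * (1 / 64) := by gcongr
        _ ≤ x / 64 := by nlinarith
    have h5 := mul_le_mul_of_nonneg_left
      (show x₀ / 8 + x ^ 2 * (d / (64 * x₀)) ≤
        (x - (1 + s') * y) * (1 + e) + (1 + s') * (y * (x - y)) by linarith) hlpos.le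
    linarith

/-- Up to `2 x₀` the noise is bounded in terms of `x₀` and becomes a multiplicative factor. Beyond
`2 x₀` it eats at most a quarter of `u x`, and `3/4 · u x` still exceeds `3/2 · u x₀`. -/
theorem pluralityFraction_exponent_le {x x₀ γ ν u : ℝ} (hx₀ : 0 < x₀) (hx : x₀ / 2 ≤ x)
    (hx1 : x ≤ 1) (hγ : γ ≤ x) (hν : 0 < ν) (hu : 0 < u) (huν : 80 * ν * u ≤ 1) :
    -(u * (x * (1 + x - γ))) + 20 * ν * u ^ 2 * x ^ 2 ≤ 80 * ν * u ^ 2 * x₀ ^ 2 + -(u * x) ∨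
      -(u * (x * (1 + x - γ))) + 20 * ν * u ^ 2 * x ^ 2 ≤ -(3 / 2 * (u * x₀)) := by
  have hxpos : 0 < x := by linarith
  have h1 : u * x ≤ u * (x * (1 + x - γ)) := by
    have : x ≤ x * (1 + x - γ) := le_mul_of_one_le_right hxpos.le (by linarith)
    exact mul_le_mul_of_nonneg_left this hu.le
  rcases le_or_gt x (2 * x₀) with h | h
  · left
    have : 20 * ν * u ^ 2 * x ^ 2 ≤ 20 * ν * u ^ 2 * (2 * x₀) ^ 2 := by gcongr
    nlinarith
  · right
    have h2 : 20 * ν * u ^ 2 * x ^ 2 ≤ u * x / 4 := by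
      have a1 : u * x * x * (80 * ν * u) ≤ u * x * x * 1 :=
        mul_le_mul_of_nonneg_left huν (by positivity)
      have a2 : u * x * x ≤ u * x := mul_le_of_le_one_right (by positivity) hx1
      nlinarith
    nlinarith

/-- The expansion of `1 / w` at `M` has the exact remainder `(w - M)² / (M² w)`. Truncating at `g`
bounds the remainder, and since `g ≤ M` it only moves the argument towards `M`. -/
theorem one_div_max_le {z M g : ℝ} (hg : 0 < g) (hM : g ≤ M) :
    1 / max z g ≤ 1 / M - (z - M) / M ^ 2 + (z - M) ^ 2 / (M ^ 2 * g) := by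
  have hMpos : 0 < M := hg.trans_le hM
  have key : ∀ w, g ≤ w → 1 / w ≤ 1 / M - (w - M) / M ^ 2 + (w - M) ^ 2 / (M ^ 2 * g) := by
    intro w hw
    have hwpos : 0 < w := hg.trans_le hw
    have e : 1 / w = 1 / M - (w - M) / M ^ 2 + (w - M) ^ 2 / (M ^ 2 * w) := by
      field_simp; ring
    rw [e]
    gcongr
  rcases le_total g z with h | h
  · rw [max_eq_left h]; exact key z h
  · rw [max_eq_right h]
    refine (key g le_rfl).trans ?_
    have h1 : (g - M) ^ 2 ≤ (z - M) ^ 2 := by nlinarith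
    gcongr

/-- The one-round contraction of the inverse plurality fraction, as an inequality of reals. -/
theorem inverse_contraction {a x₀ γ ν : ℝ} (hx₀ : 0 < x₀) (hx : x₀ / 2 ≤ a) (ha1 : a ≤ 1)
    (hγ0 : 0 ≤ γ) (hγ : a * (1 - a) / 2 ≤ a - γ) (hν : 32 * ν ≤ x₀) (hν0 : 0 ≤ ν) :
    1 / (a * (1 + a - γ)) + 2 * ν * (1 - a) * a ^ 2 / ((a * (1 + a - γ)) ^ 2 * (x₀ / 2)) - 1
      ≤ (1 - x₀ / 16) * (1 / a - 1) := by
  have ha : 0 < a := by linarith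
  set e := a - γ with he
  have e0 : 0 ≤ e := le_trans (by nlinarith) hγ
  have e1 : e ≤ 1 := by linarith
  have e2 : 1 + a - γ = 1 + e := by rw [he]; ring
  rw [e2]
  -- The drift gains `(1 - a) / 4` and the variance returns at most half of it. The factor `1 - a`
  -- in the variance is essential, because the gain vanishes at consensus.
  have h1 : 1 / (a * (1 + e)) ≤ 1 / a - (1 - a) / 4 := by
    have b1 : 1 / (1 + e) ≤ 1 - e / 2 := by
      rw [div_le_iff₀ (by linarith)]; nlinarith
    have b2 : 1 / (a * (1 + e)) = 1 / a * (1 / (1 + e)) := by field_simp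
    rw [b2]
    calc 1 / a * (1 / (1 + e)) ≤ 1 / a * (1 - e / 2) := by gcongr
      _ ≤ 1 / a * (1 - a * (1 - a) / 2 / 2) := by gcongr
      _ = 1 / a - (1 - a) / 4 := by field_simp; ring
  have h2 : 2 * ν * (1 - a) * a ^ 2 / ((a * (1 + e)) ^ 2 * (x₀ / 2)) ≤ (1 - a) / 8 := by
    rw [div_le_iff₀ (by positivity)]
    have c1 : a ^ 2 ≤ (a * (1 + e)) ^ 2 := by
      have : a ≤ a * (1 + e) := le_mul_of_one_le_right ha.le (by linarith)
      gcongr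
    have c2 : 0 ≤ 1 - a := by linarith
    calc 2 * ν * (1 - a) * a ^ 2 = (1 - a) * a ^ 2 * (32 * ν) / 16 := by ring
      _ ≤ (1 - a) * (a * (1 + e)) ^ 2 * x₀ / 16 := by gcongr
      _ = _ := by ring
  have h3 : 1 / a - (1 - a) / 8 - 1 = (1 - a / 8) * (1 / a - 1) := by field_simp; ring
  have h4 : 0 ≤ 1 / a - 1 := by
    rw [sub_nonneg, le_div_iff₀ ha]; linarith
  nlinarith

end Real

/-! ### Opinion fractions and their squared norm. -/

section Fraction

variable {V : Type*} [Fintype V] {k : ℕ}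

theorem opinionFraction_nonneg (σ : V → Fin k) (i : Fin k) : 0 ≤ opinionFraction σ i := by
  unfold opinionFraction; positivity

theorem card_mul_opinionFraction [Nonempty V] (σ : V → Fin k) (i : Fin k) :
    (Fintype.card V : ℝ) * opinionFraction σ i = ((Finset.univ.filter fun v => σ v = i).card : ℝ) := by
  unfold opinionFraction
  have : (Fintype.card V : ℝ) ≠ 0 := by simp
  field_simp

/-- Averaging a function of the opinion over the vertices. -/
theorem sum_comp_opinion [Nonempty V] (σ : V → Fin k) (w : Fin k → ℝ) :
    ∑ v, w (σ v) = (Fintype.card V : ℝ) * ∑ i, opinionFraction σ i * w i := by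
  classical
  rw [Finset.mul_sum, ← Finset.sum_fiberwise (s := Finset.univ) (g := σ)]
  refine Finset.sum_congr rfl fun i _ => ?_
  rw [← mul_assoc, card_mul_opinionFraction, ← nsmul_eq_mul, ← Finset.sum_const]
  exact Finset.sum_congr rfl fun v hv => by rw [(Finset.mem_filter.1 hv).2]

theorem sum_opinionFraction [Nonempty V] (σ : V → Fin k) : ∑ i, opinionFraction σ i = 1 := by
  have h := sum_comp_opinion σ fun _ => 1
  have : (Fintype.card V : ℝ) ≠ 0 := by simp
  simp only [Finset.sum_const, Finset.card_univ, nsmul_eq_mul, mul_one] at h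
  exact (mul_left_cancel₀ this (by rw [mul_one]; exact h)).symm

theorem opinionFraction_le_one [Nonempty V] (σ : V → Fin k) (i : Fin k) :
    opinionFraction σ i ≤ 1 := by
  rw [← sum_opinionFraction σ]
  exact Finset.single_le_sum (fun j _ => opinionFraction_nonneg σ j) (Finset.mem_univ i)

theorem opinionNormSq_nonneg (σ : V → Fin k) : 0 ≤ opinionNormSq σ :=
  Finset.sum_nonneg fun _ _ => sq_nonneg _

theorem sq_opinionFraction_le (σ : V → Fin k) (i : Fin k) :
    opinionFraction σ i ^ 2 ≤ opinionNormSq σ :=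
  Finset.single_le_sum (f := fun j => opinionFraction σ j ^ 2) (fun _ _ => sq_nonneg _)
    (Finset.mem_univ i)

theorem opinionNormSq_pos [Nonempty V] (σ : V → Fin k) : 0 < opinionNormSq σ := by
  obtain ⟨v⟩ := ‹Nonempty V›
  refine lt_of_lt_of_le ?_ (sq_opinionFraction_le σ (σ v))
  have : 0 < (Finset.univ.filter fun u => σ u = σ v).card :=
    Finset.card_pos.2 ⟨v, by simp⟩
  have h2 : 0 < Fintype.card V := Fintype.card_pos_iff.2 ⟨v⟩
  unfold opinionFraction
  positivity

theorem opinionNormSq_le_of_bound [Nonempty V] (σ : V → Fin k) (i₀ : Fin k) {b : ℝ}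
    (hb : ∀ j ≠ i₀, opinionFraction σ j ≤ b) :
    opinionNormSq σ ≤ opinionFraction σ i₀ ^ 2 + b * (1 - opinionFraction σ i₀) := by
  have h1 := Finset.add_sum_erase Finset.univ (fun j => opinionFraction σ j ^ 2) (Finset.mem_univ i₀)
  have h2 := Finset.add_sum_erase Finset.univ (opinionFraction σ) (Finset.mem_univ i₀)
  rw [sum_opinionFraction] at h2
  rw [opinionNormSq, ← h1, ← h2, add_sub_cancel_left, Finset.mul_sum]
  refine add_le_add le_rfl (Finset.sum_le_sum fun j hj => ?_)
  rw [sq]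
  exact mul_le_mul_of_nonneg_right (hb j (Finset.ne_of_mem_erase hj)) (opinionFraction_nonneg σ j)

theorem opinionNormSq_le_of_plurality [Nonempty V] {σ : V → Fin k} {i₀ : Fin k}
    (h : ∀ j, opinionFraction σ j ≤ opinionFraction σ i₀) :
    opinionNormSq σ ≤ opinionFraction σ i₀ := by
  have := opinionNormSq_le_of_bound σ i₀ fun j _ => h j
  nlinarith

/-- Fractions are multiples of `1 / n`. This granularity turns a small expectation into exact
consensus. -/
theorem opinionFraction_le_of_ne_one [Nonempty V] {σ : V → Fin k} {i : Fin k}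
    (h : opinionFraction σ i ≠ 1) : opinionFraction σ i ≤ 1 - 1 / (Fintype.card V : ℝ) := by
  have hn : (0 : ℝ) < Fintype.card V := by exact_mod_cast Fintype.card_pos
  have h1 := card_mul_opinionFraction σ i
  have h2 : (Finset.univ.filter fun v => σ v = i).card ≤ Fintype.card V := Finset.card_le_univ _
  have h3 : (Finset.univ.filter fun v => σ v = i).card ≠ Fintype.card V := by
    intro he
    rw [he] at h1
    exact h (mul_left_cancel₀ hn.ne' (by rw [h1, mul_one]))
  have h4 : ((Finset.univ.filter fun v => σ v = i).card : ℝ) + 1 ≤ Fintype.card V := by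
    exact_mod_cast lt_of_le_of_ne h2 h3
  rw [← h1] at h4
  rw [le_sub_iff_add_le, ← mul_le_mul_iff_of_pos_left hn]
  field_simp
  linarith

end Fraction

/-! ### Independent vertex updates: variance and exponential moments. -/

section ProductLaw

variable {V : Type*} [Fintype V] [DecidableEq V] {k : ℕ}

/-- Under `p` the opinions of the vertices are independent, that of `v` having law `q v`. -/
structure HasProductLaw (p : PMF (V → Fin k)) (q : V → Fin k → ℝ) : Prop where
  nonneg : ∀ v i, 0 ≤ q v i
  sum_eq_one : ∀ v, ∑ i, q v i = 1
  expect_prod : ∀ h : V → Fin k → ℝ,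
    p.expect (fun τ => ∏ v, h v (τ v)) = ∏ v, ∑ i, q v i * h v i

theorem PMF.expect_sum {S ι : Type*} [Fintype S] (p : PMF S) (J : Finset ι) (f : ι → S → ℝ) :
    p.expect (fun s => ∑ j ∈ J, f j s) = ∑ j ∈ J, p.expect (f j) := by
  simp only [PMF.expect, Finset.mul_sum]
  exact Finset.sum_comm

/-- Independent uniform choices of the vertices give a product law. -/
theorem expect_map_uniform {U : Type*} [Fintype U] [Nonempty U] (F : V → U → Fin k)
    (f : (V → Fin k) → ℝ) :
    ((PMF.uniformOfFintype (V → U)).map fun w v => F v (w v)).expect f =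
      ((Fintype.card (V → U) : ℝ))⁻¹ * ∑ w : V → U, f fun v => F v (w v) := by
  classical
  have h1 : ∀ τ : V → Fin k,
      (((PMF.uniformOfFintype (V → U)).map fun w v => F v (w v)) τ).toReal =
        ∑ w : V → U, if τ = (fun v => F v (w v)) then ((Fintype.card (V → U) : ℝ))⁻¹ else 0 := by
    intro τ
    rw [PMF.map_apply, tsum_fintype, ENNReal.toReal_sum]
    · refine Finset.sum_congr rfl fun w _ => ?_
      split_ifs <;> simp
    · intro w _
      split_ifs <;> simp
  simp only [PMF.expect, h1, Finset.sum_mul]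
  rw [Finset.sum_comm, Finset.mul_sum]
  refine Finset.sum_congr rfl fun w _ => ?_
  simp

theorem hasProductLaw_map_uniform {U : Type*} [Fintype U] [Nonempty U] (F : V → U → Fin k)
    (q : V → Fin k → ℝ) (hq : ∀ v i, 0 ≤ q v i)
    (h : ∀ v (g : Fin k → ℝ), ∑ u, g (F v u) = Fintype.card U * ∑ i, q v i * g i) :
    HasProductLaw ((PMF.uniformOfFintype (V → U)).map fun w v => F v (w v)) q where
  nonneg := hq
  sum_eq_one v := by
    have h1 := h v fun _ => 1
    have h2 : (Fintype.card U : ℝ) ≠ 0 := by simp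
    simp only [Finset.sum_const, Finset.card_univ, nsmul_eq_mul, mul_one] at h1
    exact (mul_left_cancel₀ h2 (by rw [mul_one]; exact h1)).symm
  expect_prod g := by
    have h2 : (Fintype.card U : ℝ) ≠ 0 := by simp
    rw [expect_map_uniform]
    have h3 : ∑ w : V → U, ∏ v, g v (F v (w v)) = ∏ v, ∑ u, g v (F v u) := by
      rw [Finset.prod_univ_sum, Fintype.piFinset_univ]
    rw [h3]
    simp only [h]
    rw [Finset.prod_mul_distrib, Finset.prod_const, Finset.card_univ, Fintype.card_fun]
    push_cast
    rw [← mul_assoc, inv_mul_cancel₀ (pow_ne_zero _ h2), one_mul]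

variable {p : PMF (V → Fin k)} {q : V → Fin k → ℝ}

theorem HasProductLaw.expect_single (hp : HasProductLaw p q) (v : V) (g : Fin k → ℝ) :
    p.expect (fun τ => g (τ v)) = ∑ i, q v i * g i := by
  have h := hp.expect_prod fun a i => if a = v then g i else 1
  have e : ∀ τ : V → Fin k, ∏ a, (if a = v then g (τ a) else 1) = g (τ v) := fun τ => by simp
  simp only [e] at h
  rw [h, Finset.prod_eq_single v]
  · simp
  · intro a _ ha
    simp [ha, hp.sum_eq_one]
  · simp

theorem HasProductLaw.expect_pair (hp : HasProductLaw p q) {u v : V} (huv : u ≠ v)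
    (f g : Fin k → ℝ) (hf : ∑ i, q u i * f i = 0) :
    p.expect (fun τ => f (τ u) * g (τ v)) = 0 := by
  have h := hp.expect_prod fun a i => (if a = u then f i else 1) * if a = v then g i else 1
  have e : ∀ τ : V → Fin k, ∏ a, ((if a = u then f (τ a) else 1) * if a = v then g (τ a) else 1) =
      f (τ u) * g (τ v) := fun τ => by rw [Finset.prod_mul_distrib]; simp
  simp only [e] at h
  rw [h]
  refine Finset.prod_eq_zero (Finset.mem_univ u) ?_
  simpa [huv] using hf

theorem HasProductLaw.variance_eq (hp : HasProductLaw p q) (w : Fin k → ℝ) :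
    p.expect (fun τ => (∑ v, w (τ v) - ∑ v, ∑ i, q v i * w i) ^ 2) =
      ∑ v, (∑ i, q v i * w i ^ 2 - (∑ i, q v i * w i) ^ 2) := by
  set m : V → ℝ := fun v => ∑ i, q v i * w i with hm
  have e : ∀ τ : V → Fin k, (∑ v, w (τ v) - ∑ v, m v) ^ 2 =
      ∑ u, ∑ v, (w (τ u) - m u) * (w (τ v) - m v) := by
    intro τ
    rw [← Finset.sum_sub_distrib, sq, Finset.sum_mul_sum]
  have hz : ∀ u, ∑ i, q u i * (w i - m u) = 0 := by
    intro u
    simp only [mul_sub, Finset.sum_sub_distrib, ← Finset.sum_mul, hp.sum_eq_one, one_mul]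
    exact sub_self _
  simp only [e, p.expect_sum]
  refine Finset.sum_congr rfl fun u _ => ?_
  rw [Finset.sum_eq_single u]
  · rw [hp.expect_single u fun i => (w i - m u) * (w i - m u)]
    have : ∀ i, q u i * ((w i - m u) * (w i - m u)) =
        q u i * w i ^ 2 - 2 * m u * (q u i * w i) + m u ^ 2 * q u i := fun i => by ring
    simp only [this, Finset.sum_add_distrib, Finset.sum_sub_distrib, ← Finset.mul_sum,
      hp.sum_eq_one]
    simp only [hm]; ring
  · intro v _ hvu
    exact hp.expect_pair hvu.symm (fun i => w i - m u) (fun i => w i - m v) (hz u)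
  · simp

theorem HasProductLaw.variance_le (hp : HasProductLaw p q) (w : Fin k → ℝ) (c : ℝ) (v : V) :
    ∑ i, q v i * w i ^ 2 - (∑ i, q v i * w i) ^ 2 ≤ ∑ i, q v i * (w i - c) ^ 2 := by
  have : ∀ i, q v i * (w i - c) ^ 2 = q v i * w i ^ 2 - 2 * c * (q v i * w i) + c ^ 2 * q v i :=
    fun i => by ring
  simp only [this, Finset.sum_add_distrib, Finset.sum_sub_distrib, ← Finset.mul_sum,
    hp.sum_eq_one]
  nlinarith [sq_nonneg (∑ i, q v i * w i - c)]

/-- A Bernstein bound from `exp z ≤ 1 + z + z²` for `|z| ≤ 1`. The centre `c v` may depend on the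
vertex: in 2-Choices a vertex mostly keeps its opinion, and centring there makes the quadratic term
small. -/
theorem HasProductLaw.mgf_le (hp : HasProductLaw p q) (w : Fin k → ℝ) (c : V → ℝ) {θ : ℝ}
    (hθ : ∀ v i, |θ * (w i - c v)| ≤ 1) :
    p.expect (fun τ => Real.exp (-(θ * ∑ v, w (τ v)))) ≤
      Real.exp (-(θ * ∑ v, ∑ i, q v i * w i) + θ ^ 2 * ∑ v, ∑ i, q v i * (w i - c v) ^ 2) := by
  have e : ∀ τ : V → Fin k, Real.exp (-(θ * ∑ v, w (τ v))) = ∏ v, Real.exp (-(θ * w (τ v))) := by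
    intro τ
    rw [← Real.exp_sum, Finset.mul_sum, Finset.sum_neg_distrib]
  simp only [e]
  rw [hp.expect_prod fun _ i => Real.exp (-(θ * w i)), Finset.mul_sum, Finset.mul_sum,
    ← Finset.sum_neg_distrib, ← Finset.sum_add_distrib, Real.exp_sum]
  refine Finset.prod_le_prod
    (fun v _ => Finset.sum_nonneg fun i _ => mul_nonneg (hp.nonneg v i) (Real.exp_nonneg _))
    fun v _ => ?_
  set m := ∑ i, q v i * w i with hm
  set Q := ∑ i, q v i * (w i - c v) ^ 2 with hQ
  calc ∑ i, q v i * Real.exp (-(θ * w i))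
      ≤ ∑ i, q v i * (Real.exp (-(θ * c v)) *
          (1 - θ * (w i - c v) + θ ^ 2 * (w i - c v) ^ 2)) := by
        refine Finset.sum_le_sum fun i _ => mul_le_mul_of_nonneg_left ?_ (hp.nonneg v i)
        have h1 : -(θ * w i) = -(θ * c v) + -(θ * (w i - c v)) := by ring
        rw [h1, Real.exp_add]
        refine mul_le_mul_of_nonneg_left ?_ (Real.exp_nonneg _)
        have h2 := (abs_le.1 (Real.abs_exp_sub_one_sub_id_le
          (x := -(θ * (w i - c v))) (by rw [abs_neg]; exact hθ v i))).2
        nlinarith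
    _ = Real.exp (-(θ * c v)) * (1 + (-(θ * (m - c v)) + θ ^ 2 * Q)) := by
        have : ∀ i, q v i * (Real.exp (-(θ * c v)) *
            (1 - θ * (w i - c v) + θ ^ 2 * (w i - c v) ^ 2)) =
            Real.exp (-(θ * c v)) * ((1 + θ * c v) * q v i - θ * (q v i * w i) +
              θ ^ 2 * (q v i * (w i - c v) ^ 2)) := fun i => by ring
        simp only [this, ← Finset.mul_sum, Finset.sum_add_distrib, Finset.sum_sub_distrib,
          hp.sum_eq_one]
        rw [← hm, ← hQ]; ring
    _ ≤ Real.exp (-(θ * c v)) * Real.exp (-(θ * (m - c v)) + θ ^ 2 * Q) := by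
        refine mul_le_mul_of_nonneg_left ?_ (Real.exp_nonneg _)
        rw [add_comm]; exact Real.add_one_le_exp _
    _ = Real.exp (-(θ * m) + θ ^ 2 * Q) := by
        rw [← Real.exp_add]; congr 1; ring

end ProductLaw

/-! ### The laws of the two dynamics and their common drift bounds. -/

section Steps

variable {V : Type*} [Fintype V] [DecidableEq V] [Nonempty V] {k : ℕ}

omit [DecidableEq V] in
theorem sum_ite_opinion_eq (σ : V → Fin k) (a : V) (x y : ℝ) :
    ∑ b, (if σ a = σ b then x else y) =
      Fintype.card V * (opinionFraction σ (σ a) * x + (1 - opinionFraction σ (σ a)) * y) := by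
  have h := sum_comp_opinion σ fun i => if σ a = i then x else y
  rw [h]
  congr 1
  have h1 : ∀ i, opinionFraction σ i * (if σ a = i then x else y) =
      (if σ a = i then opinionFraction σ i * (x - y) else 0) + opinionFraction σ i * y := by
    intro i; split_ifs <;> ring
  simp only [h1, Finset.sum_add_distrib, ← Finset.sum_mul, sum_opinionFraction]
  simp
  ring

-- Here `y` is the fallback when the two samples disagree: the value at the vertex's own opinion in
-- 2-Choices, the sum over the third sample in 3-Majority.
omit [DecidableEq V] in
theorem sum_twoChoices (σ : V → Fin k) (g : Fin k → ℝ) (y : ℝ) :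
    ∑ a, ∑ b, (if σ a = σ b then g (σ a) else y) = (Fintype.card V : ℝ) ^ 2 *
      (∑ i, opinionFraction σ i ^ 2 * g i + (1 - opinionNormSq σ) * y) := by
  simp only [sum_ite_opinion_eq]
  rw [sum_comp_opinion σ fun i => (Fintype.card V : ℝ) *
    (opinionFraction σ i * g i + (1 - opinionFraction σ i) * y), sq, mul_assoc]
  congr 1
  have h1 : ∀ i, opinionFraction σ i * ((Fintype.card V : ℝ) *
      (opinionFraction σ i * g i + (1 - opinionFraction σ i) * y)) =
      (Fintype.card V : ℝ) * (opinionFraction σ i ^ 2 * g i + opinionFraction σ i * y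
        - opinionFraction σ i ^ 2 * y) := fun i => by ring
  simp only [h1, ← Finset.mul_sum, Finset.sum_add_distrib, Finset.sum_sub_distrib,
    ← Finset.sum_mul, sum_opinionFraction]
  rw [opinionNormSq]; ring

omit [DecidableEq V] in
theorem opinionNormSq_le_one (σ : V → Fin k) : opinionNormSq σ ≤ 1 := by
  rw [← sum_opinionFraction σ]
  refine Finset.sum_le_sum fun i _ => ?_
  nlinarith [opinionFraction_nonneg σ i, opinionFraction_le_one σ i]

theorem hasProductLaw_threeMajorityStep (σ : V → Fin k) :
    HasProductLaw (threeMajorityStep σ) fun _ i =>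
      opinionFraction σ i ^ 2 + (1 - opinionNormSq σ) * opinionFraction σ i := by
  refine hasProductLaw_map_uniform
    (fun _ (u : Fin 3 → V) => if σ (u 0) = σ (u 1) then σ (u 0) else σ (u 2)) _ (fun _ i => ?_)
    fun _ g => ?_
  · have := opinionNormSq_le_one σ
    have := opinionFraction_nonneg σ i
    have : 0 ≤ (1 - opinionNormSq σ) * opinionFraction σ i := mul_nonneg (by linarith) this
    positivity
  · have e : ∑ u : Fin 3 → V, g (if σ (u 0) = σ (u 1) then σ (u 0) else σ (u 2)) =
        ∑ a, ∑ b, ∑ c, if σ a = σ b then g (σ a) else g (σ c) := by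
      rw [← (Fin.consEquiv fun _ => V).sum_comp, Fintype.sum_prod_type]
      refine Finset.sum_congr rfl fun a _ => ?_
      rw [← (finTwoArrowEquiv V).symm.sum_comp, Fintype.sum_prod_type]
      refine Finset.sum_congr rfl fun b _ => Finset.sum_congr rfl fun c _ => ?_
      rw [← apply_ite g]
      rfl
    rw [e]
    have e2 : ∀ a b, (∑ c, if σ a = σ b then g (σ a) else g (σ c)) =
        if σ a = σ b then Fintype.card V * g (σ a) else ∑ c, g (σ c) := by
      intro a b; split_ifs <;> simp
    simp only [e2]
    rw [sum_twoChoices σ (fun i => Fintype.card V * g i), sum_comp_opinion, Fintype.card_fun,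
      Fintype.card_fin]
    have h1 : ∀ i, opinionFraction σ i ^ 2 * ((Fintype.card V : ℝ) * g i) =
      (Fintype.card V : ℝ) * (opinionFraction σ i ^ 2 * g i) := fun i => by ring
    have h2 : ∀ i, (opinionFraction σ i ^ 2 + (1 - opinionNormSq σ) * opinionFraction σ i) * g i =
      opinionFraction σ i ^ 2 * g i + (1 - opinionNormSq σ) * (opinionFraction σ i * g i) :=
      fun i => by ring
    simp only [h1, h2, Finset.sum_add_distrib, ← Finset.mul_sum]
    push_cast; ring

theorem hasProductLaw_twoChoicesStep (σ : V → Fin k) :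
    HasProductLaw (twoChoicesStep σ) fun v i =>
      opinionFraction σ i ^ 2 + (1 - opinionNormSq σ) * if σ v = i then 1 else 0 := by
  refine hasProductLaw_map_uniform
    (fun v (u : Fin 2 → V) => if σ (u 0) = σ (u 1) then σ (u 0) else σ v) _ (fun v i => ?_)
    fun v g => ?_
  · have := opinionNormSq_le_one σ
    have : 0 ≤ (1 - opinionNormSq σ) * if σ v = i then 1 else 0 :=
      mul_nonneg (by linarith) (by split_ifs <;> norm_num)
    positivity
  · have e : ∑ u : Fin 2 → V, g (if σ (u 0) = σ (u 1) then σ (u 0) else σ v) =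
        ∑ a, ∑ b, if σ a = σ b then g (σ a) else g (σ v) := by
      rw [← (finTwoArrowEquiv V).symm.sum_comp, Fintype.sum_prod_type]
      refine Finset.sum_congr rfl fun b _ => Finset.sum_congr rfl fun c _ => ?_
      rw [← apply_ite g]
      rfl
    rw [e, sum_twoChoices, Fintype.card_fun, Fintype.card_fin]
    simp only [add_mul, Finset.sum_add_distrib, mul_assoc, ← Finset.mul_sum]
    simp

/-- The expectation and noise estimates on one round that the consensus argument uses, at
configurations in which opinion `i₀` is a plurality held by at least a fraction `x₀ / 2`. -/
structure DriftBounds (step : (V → Fin k) → PMF (V → Fin k)) (i₀ : Fin k) (x₀ ν : ℝ) : Prop where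
  mgf : ∀ σ : V → Fin k, (∀ j, opinionFraction σ j ≤ opinionFraction σ i₀) →
    x₀ / 2 ≤ opinionFraction σ i₀ → ∀ (w : Fin k → ℝ) (l : ℝ),
    (∀ i, |w i| ≤ 3) → (∀ i j, |w i - w j| ≤ 3) →
    ∑ i, opinionFraction σ i * w i ^ 2 ≤ 5 * opinionFraction σ i₀ →
    ∑ i, opinionFraction σ i ^ 2 * w i ^ 2 ≤ 5 * opinionFraction σ i₀ ^ 2 →
    0 ≤ l → 3 * l ≤ Fintype.card V →
    (step σ).expect (fun τ => Real.exp (-(l * ∑ i, opinionFraction τ i * w i))) ≤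
      Real.exp (-(l * ∑ i, opinionFraction σ i * (1 + opinionFraction σ i - opinionNormSq σ) * w i)
        + 20 * ν * l ^ 2 * opinionFraction σ i₀ ^ 2)
  mean : ∀ σ : V → Fin k, (step σ).expect (fun τ => opinionFraction τ i₀) =
    opinionFraction σ i₀ * (1 + opinionFraction σ i₀ - opinionNormSq σ)
  variance : ∀ σ : V → Fin k, (∀ j, opinionFraction σ j ≤ opinionFraction σ i₀) →
    x₀ / 2 ≤ opinionFraction σ i₀ →
    (step σ).expect (fun τ => (opinionFraction τ i₀ -
      opinionFraction σ i₀ * (1 + opinionFraction σ i₀ - opinionNormSq σ)) ^ 2) ≤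
      2 * ν * (1 - opinionFraction σ i₀) * opinionFraction σ i₀ ^ 2

/-- Reduction of the one-round estimates to bounds on the product law of the round. -/
theorem DriftBounds.of_hasProductLaw {step : (V → Fin k) → PMF (V → Fin k)} {i₀ : Fin k}
    {x₀ ν : ℝ} (q : (V → Fin k) → V → Fin k → ℝ) (hq : ∀ σ, HasProductLaw (step σ) (q σ))
    (hmean : ∀ σ (w : Fin k → ℝ), ∑ v, ∑ i, q σ v i * w i = Fintype.card V *
      ∑ i, opinionFraction σ i * (1 + opinionFraction σ i - opinionNormSq σ) * w i)
    (hquad : ∀ σ : V → Fin k, (∀ j, opinionFraction σ j ≤ opinionFraction σ i₀) →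
      x₀ / 2 ≤ opinionFraction σ i₀ → ∀ w : Fin k → ℝ,
      (∀ i, |w i| ≤ 3) → (∀ i j, |w i - w j| ≤ 3) →
      ∑ i, opinionFraction σ i * w i ^ 2 ≤ 5 * opinionFraction σ i₀ →
      ∑ i, opinionFraction σ i ^ 2 * w i ^ 2 ≤ 5 * opinionFraction σ i₀ ^ 2 →
      ∃ c : V → ℝ, (∀ v i, |w i - c v| ≤ 3) ∧
        ∑ v, ∑ i, q σ v i * (w i - c v) ^ 2 ≤
          (Fintype.card V : ℝ) ^ 2 * (20 * ν * opinionFraction σ i₀ ^ 2))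
    (hvar : ∀ σ : V → Fin k, (∀ j, opinionFraction σ j ≤ opinionFraction σ i₀) →
      x₀ / 2 ≤ opinionFraction σ i₀ →
      ∑ v, (∑ i, q σ v i * (if i = i₀ then 1 else 0) ^ 2
        - (∑ i, q σ v i * if i = i₀ then 1 else 0) ^ 2) ≤
        (Fintype.card V : ℝ) ^ 2 *
          (2 * ν * (1 - opinionFraction σ i₀) * opinionFraction σ i₀ ^ 2)) :
    DriftBounds step i₀ x₀ ν := by
  have hn : (0 : ℝ) < Fintype.card V := by exact_mod_cast Fintype.card_pos
  have hfrac : ∀ (τ : V → Fin k) (w : Fin k → ℝ),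
      ∑ i, opinionFraction τ i * w i = (Fintype.card V : ℝ)⁻¹ * ∑ v, w (τ v) := by
    intro τ w
    rw [sum_comp_opinion, inv_mul_cancel_left₀ hn.ne']
  have hfrac₀ : ∀ τ : V → Fin k, opinionFraction τ i₀ =
      (Fintype.card V : ℝ)⁻¹ * ∑ v, (if τ v = i₀ then 1 else 0) := by
    intro τ
    rw [← hfrac τ fun i => if i = i₀ then 1 else 0]
    simp
  have hmean₀ : ∀ σ : V → Fin k, opinionFraction σ i₀ *
      (1 + opinionFraction σ i₀ - opinionNormSq σ) =
      (Fintype.card V : ℝ)⁻¹ * ∑ v, ∑ i, q σ v i * (if i = i₀ then 1 else 0) := by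
    intro σ
    rw [hmean, inv_mul_cancel_left₀ hn.ne']
    simp
  constructor
  · intro σ h1 h2 w l hw hw' hw1 hw2 hl hl3
    obtain ⟨c, hc, hQ⟩ := hquad σ h1 h2 w hw hw' hw1 hw2
    -- The bound `3 * l ≤ n` is exactly what makes the exponents at most 1 in absolute value.
    have key := (hq σ).mgf_le w c (θ := l * (Fintype.card V : ℝ)⁻¹) fun v i => by
      rw [abs_mul, abs_of_nonneg (by positivity), ← div_eq_mul_inv, div_mul_eq_mul_div,
        div_le_one hn]
      nlinarith [hc v i]
    simp only [hfrac _ w, ← mul_assoc] at key ⊢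
    refine key.trans (Real.exp_le_exp.2 ?_)
    rw [hmean]
    refine add_le_add (le_of_eq ?_) ?_
    · simp only [mul_assoc]
      rw [inv_mul_cancel_left₀ hn.ne']
    · calc _ ≤ (l * (Fintype.card V : ℝ)⁻¹) ^ 2 *
            ((Fintype.card V : ℝ) ^ 2 * (20 * ν * opinionFraction σ i₀ ^ 2)) := by gcongr
        _ = _ := by field_simp
  · intro σ
    simp only [hfrac₀ _]
    rw [PMF.expect_const_mul, PMF.expect_sum, ← hfrac₀, hmean₀]
    congr 1
    exact Finset.sum_congr rfl fun v _ => (hq σ).expect_single v fun i => if i = i₀ then 1 else 0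
  · intro σ h1 h2
    have key := ((hq σ).variance_eq fun i => if i = i₀ then 1 else 0).le.trans (hvar σ h1 h2)
    rw [hmean₀]
    generalize 2 * ν * (1 - opinionFraction σ i₀) * opinionFraction σ i₀ ^ 2 = b at key ⊢
    simp only [hfrac₀, ← mul_sub, mul_pow]
    rw [PMF.expect_const_mul]
    calc _ ≤ (Fintype.card V : ℝ)⁻¹ ^ 2 * ((Fintype.card V : ℝ) ^ 2 * b) := by gcongr
      _ = _ := by field_simp

/-- All centres are 0. The quadratic term has order `x / n`, with `x` the leader's fraction; since
`x ≥ x₀ / 2`, this is at most of order `x² / (n x₀)`, hence the level `ν`. -/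
theorem driftBounds_threeMajorityStep (i₀ : Fin k) {x₀ : ℝ} (hx₀ : 0 < x₀) :
    DriftBounds (V := V) threeMajorityStep i₀ x₀ (2 / (Fintype.card V * x₀)) := by
  have hn : (0 : ℝ) < Fintype.card V := by exact_mod_cast Fintype.card_pos
  have hmean : ∀ (σ : V → Fin k) (w : Fin k → ℝ), ∑ i, (opinionFraction σ i ^ 2 +
      (1 - opinionNormSq σ) * opinionFraction σ i) * w i =
      ∑ i, opinionFraction σ i * (1 + opinionFraction σ i - opinionNormSq σ) * w i :=
    fun σ w => Finset.sum_congr rfl fun i _ => by ring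
  refine DriftBounds.of_hasProductLaw _ hasProductLaw_threeMajorityStep (fun σ w => ?_) ?_ ?_
  · simp only [hmean]
    simp
  · intro σ _ hx w hw _ hw1 _
    refine ⟨fun _ => 0, fun _ i => by simpa using hw i, ?_⟩
    simp only [sub_zero, hmean, Finset.sum_const, Finset.card_univ, nsmul_eq_mul]
    have h1 : ∑ i, opinionFraction σ i * (1 + opinionFraction σ i - opinionNormSq σ) * w i ^ 2 ≤
        2 * ∑ i, opinionFraction σ i * w i ^ 2 := by
      rw [Finset.mul_sum]
      refine Finset.sum_le_sum fun i _ => ?_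
      have a1 := opinionFraction_nonneg σ i
      have a2 := opinionFraction_le_one σ i
      have a3 := opinionNormSq_nonneg σ
      have a4 : 0 ≤ opinionFraction σ i * w i ^ 2 := by positivity
      nlinarith
    have hx' : 0 < opinionFraction σ i₀ := by linarith
    have e : (Fintype.card V : ℝ) ^ 2 * (20 * (2 / (Fintype.card V * x₀)) *
        opinionFraction σ i₀ ^ 2) =
        Fintype.card V * (40 * opinionFraction σ i₀ * (opinionFraction σ i₀ / x₀)) := by
      field_simp; norm_num
    rw [e]
    refine mul_le_mul_of_nonneg_left ?_ hn.le
    have h2 : 1 / 2 ≤ opinionFraction σ i₀ / x₀ := by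
      rw [le_div_iff₀ hx₀]; linarith
    nlinarith
  · intro σ hpl hx
    simp only [hmean, Finset.sum_const, Finset.card_univ, nsmul_eq_mul]
    have hx' : 0 < opinionFraction σ i₀ := by linarith
    have e : (Fintype.card V : ℝ) ^ 2 * (2 * (2 / (Fintype.card V * x₀)) *
        (1 - opinionFraction σ i₀) * opinionFraction σ i₀ ^ 2) =
        Fintype.card V * (4 * (1 - opinionFraction σ i₀) * opinionFraction σ i₀ *
          (opinionFraction σ i₀ / x₀)) := by
      field_simp; ring
    rw [e]
    refine mul_le_mul_of_nonneg_left ?_ hn.le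
    have h2 : 1 / 2 ≤ opinionFraction σ i₀ / x₀ := by
      rw [le_div_iff₀ hx₀]; linarith
    have h3 := opinionNormSq_le_of_plurality hpl
    have h4 := opinionFraction_le_one σ i₀
    have h5 := opinionNormSq_nonneg σ
    simp only [ite_pow, one_pow, ne_eq, OfNat.ofNat_ne_zero, not_false_eq_true, zero_pow,
      mul_ite, mul_one, mul_zero, Finset.sum_ite_eq', Finset.mem_univ, if_true]
    set x := opinionFraction σ i₀
    set P := x * (1 + x - opinionNormSq σ) with hP
    have p1 : x ≤ P := le_mul_of_one_le_right hx'.le (by linarith)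
    have p2 : P ≤ 2 * x := by nlinarith
    have p3 : P - P ^ 2 ≤ 2 * x * (1 - x) := by nlinarith
    have p4 : 0 ≤ 4 * (1 - x) * x := by nlinarith
    nlinarith

/-- A vertex changes opinion only if its samples agree, so with its own opinion as centre each
squared deviation carries weights `α(i)²`. Together with `γ ≤ x`, for `x` the leader's fraction,
this gives noise of order `x² / n`, without the loss of `x₀`. -/
theorem driftBounds_twoChoicesStep (i₀ : Fin k) (x₀ : ℝ) :
    DriftBounds (V := V) twoChoicesStep i₀ x₀ (1 / Fintype.card V) := by
  have hn : (0 : ℝ) < Fintype.card V := by exact_mod_cast Fintype.card_pos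
  have hsum : ∀ (σ : V → Fin k) (v : V) (f : Fin k → ℝ), ∑ i, (opinionFraction σ i ^ 2 +
      (1 - opinionNormSq σ) * if σ v = i then 1 else 0) * f i =
      ∑ i, opinionFraction σ i ^ 2 * f i + (1 - opinionNormSq σ) * f (σ v) := by
    intro σ v f
    simp only [add_mul, Finset.sum_add_distrib, mul_assoc, ← Finset.mul_sum]
    simp
  refine DriftBounds.of_hasProductLaw _ hasProductLaw_twoChoicesStep (fun σ w => ?_) ?_ ?_
  · simp only [hsum, Finset.sum_add_distrib, ← Finset.mul_sum]
    rw [sum_comp_opinion σ w, Finset.sum_const, Finset.card_univ, nsmul_eq_mul]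
    have : ∀ i, opinionFraction σ i * (1 + opinionFraction σ i - opinionNormSq σ) * w i =
      opinionFraction σ i ^ 2 * w i + (1 - opinionNormSq σ) * (opinionFraction σ i * w i) :=
      fun i => by ring
    simp only [this, Finset.sum_add_distrib, ← Finset.mul_sum]
    ring
  · intro σ hpl hx w _ hw hw1 hw2
    refine ⟨fun v => w (σ v), fun v i => hw _ _, ?_⟩
    have hv : ∀ v, ∑ i, (opinionFraction σ i ^ 2 + (1 - opinionNormSq σ) * if σ v = i then 1 else 0) *
        (w i - w (σ v)) ^ 2 ≤
        2 * ∑ i, opinionFraction σ i ^ 2 * w i ^ 2 + 2 * opinionNormSq σ * w (σ v) ^ 2 := by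
      intro v
      rw [hsum σ v fun i => (w i - w (σ v)) ^ 2, opinionNormSq, sub_self, Finset.mul_sum,
        Finset.mul_sum, Finset.sum_mul, ← Finset.sum_add_distrib, sq (0 : ℝ), mul_zero, mul_zero,
        add_zero]
      refine Finset.sum_le_sum fun i _ => ?_
      nlinarith [mul_nonneg (sq_nonneg (opinionFraction σ i)) (sq_nonneg (w i + w (σ v)))]
    refine (Finset.sum_le_sum fun v _ => hv v).trans ?_
    rw [Finset.sum_add_distrib, Finset.sum_const, Finset.card_univ, nsmul_eq_mul,
      ← Finset.mul_sum, sum_comp_opinion σ fun i => w i ^ 2]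
    have e : (Fintype.card V : ℝ) ^ 2 * (20 * (1 / Fintype.card V) * opinionFraction σ i₀ ^ 2) =
        Fintype.card V * (20 * opinionFraction σ i₀ ^ 2) := by field_simp
    have h3 := opinionNormSq_le_of_plurality hpl
    have h4 : opinionNormSq σ * ∑ i, opinionFraction σ i * w i ^ 2 ≤
        opinionFraction σ i₀ * (5 * opinionFraction σ i₀) :=
      mul_le_mul h3 hw1 (Finset.sum_nonneg fun i _ => mul_nonneg (opinionFraction_nonneg σ i)
        (sq_nonneg _)) (opinionFraction_nonneg σ i₀)
    rw [e]
    calc _ = (Fintype.card V : ℝ) * (2 * ∑ i, opinionFraction σ i ^ 2 * w i ^ 2 +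
          2 * (opinionNormSq σ * ∑ i, opinionFraction σ i * w i ^ 2)) := by ring
      _ ≤ _ := mul_le_mul_of_nonneg_left (by nlinarith) hn.le
  · intro σ hpl _
    set w : Fin k → ℝ := fun i => if i = i₀ then 1 else 0 with hw
    have hv : ∀ v, ∑ i, (opinionFraction σ i ^ 2 + (1 - opinionNormSq σ) * if σ v = i then 1 else 0) *
        (w i - w (σ v)) ^ 2 = opinionFraction σ i₀ ^ 2 +
          (opinionNormSq σ - 2 * opinionFraction σ i₀ ^ 2) * w (σ v) := by
      intro v
      have h1 : ∀ i, opinionFraction σ i ^ 2 * (w i - w (σ v)) ^ 2 =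
          (if i = i₀ then opinionFraction σ i ^ 2 * (1 - 2 * w (σ v)) else 0) +
            opinionFraction σ i ^ 2 * w (σ v) := by
        intro i
        simp only [hw]
        split_ifs <;> ring
      rw [hsum σ v fun i => (w i - w (σ v)) ^ 2]
      simp only [h1, Finset.sum_add_distrib, ← Finset.sum_mul]
      rw [← opinionNormSq]
      simp
      ring
    refine (Finset.sum_le_sum fun v _ =>
      ((hasProductLaw_twoChoicesStep σ).variance_le w (w (σ v)) v).trans_eq (hv v)).trans ?_
    rw [Finset.sum_add_distrib, ← Finset.mul_sum, sum_comp_opinion σ w, Finset.sum_const,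
      Finset.card_univ, nsmul_eq_mul]
    have e : (Fintype.card V : ℝ) ^ 2 * (2 * (1 / Fintype.card V) * (1 - opinionFraction σ i₀) *
        opinionFraction σ i₀ ^ 2) =
        Fintype.card V * (2 * (1 - opinionFraction σ i₀) * opinionFraction σ i₀ ^ 2) := by
      field_simp
    have h1 : ∑ i, opinionFraction σ i * w i = opinionFraction σ i₀ := by simp [hw]
    have h3 := mul_le_mul_of_nonneg_right (opinionNormSq_le_of_plurality hpl)
      (opinionFraction_nonneg σ i₀)
    rw [e, h1]
    calc _ = (Fintype.card V : ℝ) * (opinionFraction σ i₀ ^ 2 +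
          (opinionNormSq σ - 2 * opinionFraction σ i₀ ^ 2) * opinionFraction σ i₀) := by ring
      _ ≤ _ := mul_le_mul_of_nonneg_left (by nlinarith) hn.le

end Steps

/-! ### One-round supermartingale estimates. -/

section Consensus

variable {V : Type*} [Fintype V] [DecidableEq V] [Nonempty V] {k : ℕ}
  {step : (V → Fin k) → PMF (V → Fin k)} {i₀ : Fin k} {x₀ ν : ℝ}

omit [Nonempty V] in
theorem DriftBounds.mgf_bias (h : DriftBounds step i₀ x₀ ν) {σ : V → Fin k}
    (hpl : ∀ j, opinionFraction σ j ≤ opinionFraction σ i₀) (hx : x₀ / 2 ≤ opinionFraction σ i₀)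
    {j : Fin k} (hj : j ≠ i₀) {b l : ℝ} (hb0 : 0 ≤ b) (hb : b ≤ 2) (hl : 0 ≤ l)
    (hl3 : 3 * l ≤ Fintype.card V) :
    (step σ).expect (fun τ => Real.exp (-(l * (opinionFraction τ i₀ - b * opinionFraction τ j)))) ≤
      Real.exp (-(l * (opinionFraction σ i₀ * (1 + opinionFraction σ i₀ - opinionNormSq σ)
          - b * (opinionFraction σ j * (1 + opinionFraction σ j - opinionNormSq σ))))
        + 20 * ν * l ^ 2 * opinionFraction σ i₀ ^ 2) := by
  -- These weights dictate the constants in `DriftBounds`: they lie in `[-2, 1]`, which gives 3, and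
  -- `1 + b² ≤ 5`.
  set w : Fin k → ℝ := fun i => (if i = i₀ then 1 else 0) - if i = j then b else 0 with hw
  have hsum : ∀ f : Fin k → ℝ, ∑ i, f i * w i = f i₀ - b * f j := by
    intro f
    simp [hw, mul_sub, Finset.sum_sub_distrib, mul_comm]
  have hsum2 : ∀ f : Fin k → ℝ, ∑ i, f i * w i ^ 2 = f i₀ + b ^ 2 * f j := by
    intro f
    have : ∀ i, w i ^ 2 = (if i = i₀ then 1 else 0) + if i = j then b ^ 2 else 0 := by
      intro i
      simp only [hw]
      by_cases h1 : i = i₀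
      · subst h1; simp [hj.symm]
      · simp [h1]
    simp [this, mul_add, Finset.sum_add_distrib, mul_comm]
  have hcase : ∀ i, -2 ≤ w i ∧ w i ≤ 1 := by
    intro i
    simp only [hw]
    by_cases h1 : i = i₀
    · subst h1; simp [hj.symm]; norm_num
    · by_cases h2 : i = j
      · simp [h2, hj]; constructor <;> linarith
      · simp [h1, h2]
  have hy := hpl j
  have hy0 := opinionFraction_nonneg σ j
  have hb2 : b ^ 2 ≤ 4 := by nlinarith
  have key := h.mgf σ hpl hx w l
    (fun i => abs_le.2 ⟨by linarith [hcase i], by linarith [hcase i]⟩)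
    (fun i i' => abs_le.2 ⟨by linarith [hcase i, hcase i'], by linarith [hcase i, hcase i']⟩)
    (by rw [hsum2]; nlinarith)
    (by
      rw [hsum2 fun i => opinionFraction σ i ^ 2]
      have : opinionFraction σ j ^ 2 ≤ opinionFraction σ i₀ ^ 2 := by gcongr
      have : b ^ 2 * opinionFraction σ j ^ 2 ≤ 4 * opinionFraction σ i₀ ^ 2 := by gcongr
      linarith) hl hl3
  rw [hsum fun i => opinionFraction σ i * (1 + opinionFraction σ i - opinionNormSq σ)] at key
  simpa only [hsum] using key

omit [Nonempty V] in
theorem DriftBounds.mgf_plurality (h : DriftBounds step i₀ x₀ ν) {σ : V → Fin k}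
    (hpl : ∀ j, opinionFraction σ j ≤ opinionFraction σ i₀) (hx : x₀ / 2 ≤ opinionFraction σ i₀)
    {l : ℝ} (hl : 0 ≤ l) (hl3 : 3 * l ≤ Fintype.card V) :
    (step σ).expect (fun τ => Real.exp (-(l * opinionFraction τ i₀))) ≤
      Real.exp (-(l * (opinionFraction σ i₀ * (1 + opinionFraction σ i₀ - opinionNormSq σ)))
        + 20 * ν * l ^ 2 * opinionFraction σ i₀ ^ 2) := by
  set w : Fin k → ℝ := fun i => if i = i₀ then 1 else 0 with hw
  have hsum : ∀ f : Fin k → ℝ, ∑ i, f i * w i = f i₀ := by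
    intro f; simp [hw]
  have hsum2 : ∀ f : Fin k → ℝ, ∑ i, f i * w i ^ 2 = f i₀ := by
    intro f; simp [hw]
  have hcase : ∀ i, 0 ≤ w i ∧ w i ≤ 1 := by
    intro i
    simp only [hw]
    split_ifs <;> norm_num
  have hx0 := opinionFraction_nonneg σ i₀
  have key := h.mgf σ hpl hx w l
    (fun i => abs_le.2 ⟨by linarith [hcase i], by linarith [hcase i]⟩)
    (fun i i' => abs_le.2 ⟨by linarith [hcase i, hcase i'], by linarith [hcase i, hcase i']⟩)
    (by rw [hsum2]; linarith)
    (by rw [hsum2 fun i => opinionFraction σ i ^ 2]; nlinarith [sq_nonneg (opinionFraction σ i₀)])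
    hl hl3
  rw [hsum fun i => opinionFraction σ i * (1 + opinionFraction σ i - opinionNormSq σ)] at key
  simpa only [hsum] using key

/-- The configurations in which `i₀` has at least a fraction `x₀ / 2` of the vertices and exceeds
every other opinion by the factor `1 + s`. -/
def dominating (V : Type*) [Fintype V] {k : ℕ} (i₀ : Fin k) (x₀ s : ℝ) : Set (V → Fin k) :=
  {σ | x₀ / 2 ≤ opinionFraction σ i₀ ∧
    ∀ j ≠ i₀, (1 + s) * opinionFraction σ j ≤ opinionFraction σ i₀}

omit [DecidableEq V] [Nonempty V] in
theorem dominating.plurality {s : ℝ} (hs : 0 ≤ s) {σ : V → Fin k} (h : σ ∈ dominating V i₀ x₀ s)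
    (j : Fin k) : opinionFraction σ j ≤ opinionFraction σ i₀ := by
  by_cases hj : j = i₀
  · rw [hj]
  · have := h.2 j hj
    nlinarith [opinionFraction_nonneg σ j]

/-- The threshold rises from `s` to `s'` within the round, so iterating this makes each rival fall
behind geometrically without an increase of the exponential moment beyond the additive error. -/
theorem DriftBounds.expect_bias_le (h : DriftBounds step i₀ x₀ ν) {s s' d l : ℝ}
    {σ : V → Fin k} (hσ : σ ∈ dominating V i₀ x₀ s) (hx₀ : 0 < x₀) (hss' : s ≤ s') (hs'1 : s' ≤ 1)
    (hs' : s' ≤ (1 + x₀ / 32) * s) (hs : d / (2 * x₀) ≤ s) (hd : 0 < d) (hdx : d ≤ x₀)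
    (hν : 0 < ν) (hνn : 1 ≤ ν * Fintype.card V) (hl : l = d / (1280 * ν * x₀))
    {j : Fin k} (hj : j ≠ i₀) :
    (step σ).expect (fun τ =>
      Real.exp (-(l * (opinionFraction τ i₀ - (1 + s') * opinionFraction τ j)))) ≤
      1 * Real.exp (-(l * (opinionFraction σ i₀ - (1 + s) * opinionFraction σ j)))
        + Real.exp (-(l * (x₀ / 8))) := by
  have hspos : 0 < s := lt_of_lt_of_le (by positivity) hs
  have hpl := dominating.plurality hspos.le hσ
  have hlpos : 0 < l := by rw [hl]; positivity
  have hl3 : 3 * l ≤ Fintype.card V := by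
    have h1 : l * (1280 * ν * x₀) = d := by rw [hl]; field_simp
    have h2 : 3 * l * (ν * x₀) ≤ Fintype.card V * (ν * x₀) := by nlinarith
    exact le_of_mul_le_mul_right h2 (by positivity)
  refine (h.mgf_bias hpl hσ.1 hj (b := 1 + s') (by linarith) (by linarith) hlpos.le hl3).trans ?_
  rw [one_mul]
  rcases pluralityBias_exponent_le hx₀ hσ.1 (opinionFraction_le_one σ i₀) (opinionNormSq_nonneg σ)
    (opinionNormSq_le_of_plurality hpl) (hσ.2 j hj) hss' hs'1 hs' hs hd hdx hν hl
    (opinionFraction_nonneg σ j) with h1 | h1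
  · exact (Real.exp_le_exp.2 h1).trans (le_add_of_nonneg_right (Real.exp_nonneg _))
  · exact (Real.exp_le_exp.2 h1).trans (le_add_of_nonneg_left (Real.exp_nonneg _))

theorem DriftBounds.expect_plurality_le (h : DriftBounds step i₀ x₀ ν) {s u : ℝ}
    {σ : V → Fin k} (hσ : σ ∈ dominating V i₀ x₀ s) (hx₀ : 0 < x₀) (hs : 0 ≤ s) (hν : 0 < ν)
    (hu : 0 < u) (huν : 80 * ν * u ≤ 1) (hνn : 1 ≤ ν * Fintype.card V) :
    (step σ).expect (fun τ => Real.exp (-(u * opinionFraction τ i₀))) ≤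
      Real.exp (80 * ν * u ^ 2 * x₀ ^ 2) * Real.exp (-(u * opinionFraction σ i₀))
        + Real.exp (-(3 / 2 * (u * x₀))) := by
  have hpl := dominating.plurality hs hσ
  have hu3 : 3 * u ≤ Fintype.card V := by
    have h2 : 3 * u * ν ≤ Fintype.card V * ν := by nlinarith
    exact le_of_mul_le_mul_right h2 hν
  refine (h.mgf_plurality hpl hσ.1 hu.le hu3).trans ?_
  rw [← Real.exp_add]
  rcases pluralityFraction_exponent_le hx₀ hσ.1 (opinionFraction_le_one σ i₀)
    (opinionNormSq_le_of_plurality hpl) hν hu huν with h1 | h1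
  · exact (Real.exp_le_exp.2 h1).trans (le_add_of_nonneg_right (Real.exp_nonneg _))
  · exact (Real.exp_le_exp.2 h1).trans (le_add_of_nonneg_left (Real.exp_nonneg _))

/-- Expand at the conditional mean `M`: the linear term has expectation zero and only the variance
remains. The truncation at `x₀ / 2` keeps the function bounded even if the next state leaves the
good set. -/
theorem DriftBounds.expect_inverse_le (h : DriftBounds step i₀ x₀ ν) {σ : V → Fin k}
    (hσ : σ ∈ dominating V i₀ x₀ 1) (hx₀ : 0 < x₀) (hν : 0 ≤ ν) (hνx : 32 * ν ≤ x₀) :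
    (step σ).expect (fun τ => 1 / max (opinionFraction τ i₀) (x₀ / 2) - 1) ≤
      (1 - x₀ / 16) * (1 / max (opinionFraction σ i₀) (x₀ / 2) - 1) := by
  have hpl := dominating.plurality zero_le_one hσ
  have hvar := h.variance σ hpl hσ.1
  have hmean := h.mean σ
  have hx := hσ.1
  have hx1 := opinionFraction_le_one σ i₀
  have hγ : opinionFraction σ i₀ * (1 - opinionFraction σ i₀) / 2 ≤
      opinionFraction σ i₀ - opinionNormSq σ := by
    have := opinionNormSq_le_of_bound σ i₀ (b := opinionFraction σ i₀ / 2) fun j hj => by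
      linarith [hσ.2 j hj]
    linarith
  have hγ' := opinionNormSq_le_of_plurality hpl
  rw [max_eq_left hx]
  refine le_trans ?_ (inverse_contraction hx₀ hx hx1 (opinionNormSq_nonneg σ) hγ hνx hν)
  set M := opinionFraction σ i₀ * (1 + opinionFraction σ i₀ - opinionNormSq σ) with hM
  have hxM : opinionFraction σ i₀ ≤ M :=
    le_mul_of_one_le_right (by linarith) (by linarith)
  calc _ ≤ (step σ).expect (fun τ => (1 / M + 1 / M - 1) + (-(1 / M ^ 2)) * opinionFraction τ i₀ +
        1 / (M ^ 2 * (x₀ / 2)) * (opinionFraction τ i₀ - M) ^ 2) := by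
        refine PMF.expect_mono _ fun τ => ?_
        have := one_div_max_le (z := opinionFraction τ i₀) (half_pos hx₀) (hx.trans hxM)
        have hM0 : M ≠ 0 := by linarith
        have e : (opinionFraction τ i₀ - M) / M ^ 2 = 1 / M ^ 2 * opinionFraction τ i₀ - 1 / M := by
          field_simp
        have e2 : (opinionFraction τ i₀ - M) ^ 2 / (M ^ 2 * (x₀ / 2)) =
          1 / (M ^ 2 * (x₀ / 2)) * (opinionFraction τ i₀ - M) ^ 2 := by ring
        linarith
    _ = (1 / M + 1 / M - 1) + (-(1 / M ^ 2)) * M + 1 / (M ^ 2 * (x₀ / 2)) *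
        (step σ).expect (fun τ => (opinionFraction τ i₀ - M) ^ 2) := by
        rw [PMF.expect_add, PMF.expect_add, PMF.expect_const, PMF.expect_const_mul,
          PMF.expect_const_mul, hmean]
    _ ≤ (1 / M + 1 / M - 1) + (-(1 / M ^ 2)) * M + 1 / (M ^ 2 * (x₀ / 2)) *
        (2 * ν * (1 - opinionFraction σ i₀) * opinionFraction σ i₀ ^ 2) := by gcongr
    _ = _ := by
        have hM0 : M ≠ 0 := by linarith
        field_simp
        ring

end Consensus

/-! ### Iteration over time and the consensus theorem. -/

section Consensus

variable {V : Type*} [Fintype V] [DecidableEq V] [Nonempty V] {k : ℕ}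
  {step : (V → Fin k) → PMF (V → Fin k)} {i₀ : Fin k} {x₀ ν : ℝ}

theorem inv_le_one_add_pow {x n : ℝ} {N t : ℕ} (hx : 0 < x) (hx1 : x ≤ 1) (hn : 0 < n)
    (hN : 64 * Real.log n ≤ x * N) (hNt : N ≤ t) : n ≤ (1 + x / 32) ^ t := by
  have h1 : Real.exp (x / 64) ≤ 1 + x / 32 := by
    have := (abs_le.1 (Real.abs_exp_sub_one_sub_id_le (x := x / 64)
      (by rw [abs_of_pos (by positivity)]; linarith))).2
    nlinarith
  calc n = Real.exp (Real.log n) := (Real.exp_log hn).symm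
    _ ≤ Real.exp (N * (x / 64)) := Real.exp_le_exp.2 (by linarith)
    _ = Real.exp (x / 64) ^ N := Real.exp_nat_mul _ _
    _ ≤ (1 + x / 32) ^ N := by gcongr
    _ ≤ (1 + x / 32) ^ t := pow_le_pow_right₀ (by linarith) hNt

theorem one_sub_pow_le_inv {x n : ℝ} {N : ℕ} (hx1 : x ≤ 1) (hn : 0 < n)
    (hN : 64 * Real.log n ≤ x * N) : (1 - x / 16) ^ N ≤ (n ^ 4)⁻¹ := by
  have h1 : 1 - x / 16 ≤ Real.exp (-(x / 16)) := by
    have := Real.add_one_le_exp (-(x / 16)); linarith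
  calc (1 - x / 16) ^ N ≤ Real.exp (-(x / 16)) ^ N := by
        gcongr; linarith
    _ = Real.exp (N * -(x / 16)) := (Real.exp_nat_mul _ _).symm
    _ ≤ Real.exp (-((4 : ℕ) * Real.log n)) := Real.exp_le_exp.2 (by push_cast; linarith)
    _ = (n ^ 4)⁻¹ := by rw [Real.exp_neg, Real.exp_nat_mul, Real.exp_log hn]

/-- The plurality opinion stays above half of its initial fraction. -/
theorem DriftBounds.killedSum_plurality_le (h : DriftBounds step i₀ x₀ ν) {σ₀ : V → Fin k}
    (hσ₀ : opinionFraction σ₀ i₀ = x₀) (hx₀ : 0 < x₀) (hν : 0 < ν)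
    (hνn : 1 ≤ ν * Fintype.card V) (hl1 : 1 ≤ Real.log (Fintype.card V))
    (hC : 10 ^ 7 * ν * Real.log (Fintype.card V) ^ 2 ≤ x₀) {s : ℕ → ℝ} (hs : ∀ t, 0 ≤ s t) {t : ℕ}
    (ht : t * x₀ ≤ 130 * Real.log (Fintype.card V)) (htn : (t : ℝ) ≤ Fintype.card V) :
    killedSum step σ₀ (fun t => dominating V i₀ x₀ (s t)) t
      (fun τ => Real.exp (-(16 * Real.log (Fintype.card V) / x₀ * (opinionFraction τ i₀ - x₀ / 2))))
      ≤ 2 * ((Fintype.card V : ℝ) ^ 6)⁻¹ := by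
  have hn : (1 : ℝ) ≤ Fintype.card V := by exact_mod_cast Fintype.card_pos
  set n : ℝ := (Fintype.card V : ℝ) with hnV
  set L := Real.log n with hL
  -- With `u x₀ = 16 L` the initial value is `n⁻¹⁶` and the additive error `n⁻²⁴`; shifting by `x₀ /
  -- 2` costs only `n⁸`.
  set u := 16 * L / x₀ with hu
  have hux : u * x₀ = 16 * L := by rw [hu]; field_simp
  have hupos : 0 < u := by rw [hu]; positivity
  have huν : 80 * ν * u ≤ 1 := by
    have h1 : 80 * ν * u * x₀ ≤ 1 * x₀ := by
      calc 80 * ν * u * x₀ = 1280 * ν * L := by rw [mul_assoc, hux]; ring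
        _ ≤ 10 ^ 7 * ν * L ^ 2 := by nlinarith [mul_pos hν (by linarith : 0 < L)]
        _ ≤ 1 * x₀ := by linarith
    exact le_of_mul_le_mul_right h1 hx₀
  have key := killedSum_le_of_drift step σ₀ (fun t => dominating V i₀ x₀ (s t))
    (fun _ τ => Real.exp (-(u * opinionFraction τ i₀)))
    (Real.one_le_exp (by positivity : 0 ≤ 80 * ν * u ^ 2 * x₀ ^ 2))
    (Real.exp_nonneg (-(3 / 2 * (u * x₀)))) (fun _ _ => Real.exp_nonneg _)
    (fun t σ hσ => h.expect_plurality_le hσ hx₀ (hs t) hν hupos huν hνn) t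
  -- The growth rate `20480 ν L²` accumulates over up to `130 L / x₀` rounds; the squared logarithm
  -- in `hC` pays for this.
  have hpow : Real.exp (80 * ν * u ^ 2 * x₀ ^ 2) ^ t ≤ n := by
    rw [← Real.exp_nat_mul, ← Real.exp_log (by linarith : 0 < n), ← hL]
    refine Real.exp_le_exp.2 ?_
    have e : 80 * ν * u ^ 2 * x₀ ^ 2 = 20480 * (ν * L ^ 2) := by
      calc _ = 80 * ν * (u * x₀) ^ 2 := by ring
        _ = _ := by rw [hux]; ring
    rw [e]
    have h1 : ν * L ^ 2 ≤ x₀ / 10 ^ 7 := by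
      rw [le_div_iff₀ (by norm_num)]; linarith
    calc (t : ℝ) * (20480 * (ν * L ^ 2)) ≤ t * (20480 * (x₀ / 10 ^ 7)) := by gcongr
      _ = t * x₀ * (20480 / 10 ^ 7) := by ring
      _ ≤ 130 * L * (20480 / 10 ^ 7) := by gcongr
      _ ≤ L := by linarith
  have hexp : ∀ m : ℕ, Real.exp (-(m * L)) = (n ^ m)⁻¹ := by
    intro m; rw [Real.exp_neg, Real.exp_nat_mul, hL, Real.exp_log (by linarith)]
  have e1 : Real.exp (-(u * opinionFraction σ₀ i₀)) = (n ^ 16)⁻¹ := by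
    rw [hσ₀, hux, ← hexp]; norm_num
  have e2 : Real.exp (-(3 / 2 * (u * x₀))) = (n ^ 24)⁻¹ := by
    rw [hux, ← hexp]; congr 1; push_cast; ring
  rw [e1, e2] at key
  have e3 : ∀ τ : V → Fin k, Real.exp (-(u * (opinionFraction τ i₀ - x₀ / 2))) =
      n ^ 8 * Real.exp (-(u * opinionFraction τ i₀)) := by
    intro τ
    have : n ^ 8 = Real.exp (u * x₀ / 2) := by
      rw [hux, ← Real.exp_log (by linarith : 0 < n), ← hL, ← Real.exp_nat_mul]
      congr 1; push_cast; ring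
    rw [this, ← Real.exp_add]; congr 1; ring
  simp only [e3]
  rw [killedSum_const_mul]
  have h24 : (n ^ 24)⁻¹ * t ≤ (n ^ 16)⁻¹ := by
    rw [inv_mul_le_iff₀ (by positivity)]
    calc (t : ℝ) ≤ n := htn
      _ ≤ n ^ 8 := le_self_pow₀ hn (by norm_num)
      _ = n ^ 24 * (n ^ 16)⁻¹ := by field_simp
  calc _ ≤ n ^ 8 * (n * ((n ^ 16)⁻¹ + (n ^ 16)⁻¹)) := by
        refine mul_le_mul_of_nonneg_left (key.trans ?_) (by positivity)
        exact mul_le_mul hpow (by linarith) (by positivity) (by linarith)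
    _ = 2 * (n ^ 7)⁻¹ := by field_simp; ring
    _ ≤ _ := by gcongr; norm_num

/-- Every rival stays below the plurality opinion by the factor prescribed by `s`. -/
theorem DriftBounds.killedSum_bias_le (h : DriftBounds step i₀ x₀ ν) {σ₀ : V → Fin k}
    (hσ₀ : opinionFraction σ₀ i₀ = x₀) (hx₀ : 0 < x₀) (hν : 0 < ν)
    (hνn : 1 ≤ ν * Fintype.card V) {d : ℝ} (hd : 0 < d) (hdx : d ≤ x₀)
    (hC : 10 ^ 7 * ν * x₀ * Real.log (Fintype.card V) = d ^ 2)
    {j : Fin k} (hj : j ≠ i₀) (hbias : d ≤ opinionFraction σ₀ i₀ - opinionFraction σ₀ j)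
    {s : ℕ → ℝ} (hs0 : s 0 ≤ d / (2 * x₀)) (hs : ∀ t, d / (2 * x₀) ≤ s t) (hmono : ∀ t, s t ≤ s (t + 1))
    (hs1 : ∀ t, s t ≤ 1) (hsucc : ∀ t, s (t + 1) ≤ (1 + x₀ / 32) * s t) {t : ℕ}
    (htn : (t : ℝ) ≤ Fintype.card V) :
    killedSum step σ₀ (fun t => dominating V i₀ x₀ (s t)) t
      (fun τ => Real.exp (-(d / (1280 * ν * x₀) *
        (opinionFraction τ i₀ - (1 + s t) * opinionFraction τ j))))
      ≤ 2 * ((Fintype.card V : ℝ) ^ 5)⁻¹ := by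
  have hn : (1 : ℝ) ≤ Fintype.card V := by exact_mod_cast Fintype.card_pos
  set n : ℝ := (Fintype.card V : ℝ) with hnV
  set L := Real.log n with hL
  have hL0 : 0 ≤ L := Real.log_nonneg hn
  set l := d / (1280 * ν * x₀) with hl
  have hlpos : 0 < l := by rw [hl]; positivity
  have hld : 48 * L ≤ l * d := by
    rw [hl, div_mul_eq_mul_div, ← sq, ← hC, le_div_iff₀ (by positivity)]
    have : 0 ≤ ν * x₀ * L := by positivity
    linarith
  have key := killedSum_le_of_drift step σ₀ (fun t => dominating V i₀ x₀ (s t))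
    (fun t τ => Real.exp (-(l * (opinionFraction τ i₀ - (1 + s t) * opinionFraction τ j))))
    le_rfl (Real.exp_nonneg (-(l * (x₀ / 8)))) (fun _ _ => Real.exp_nonneg _)
    (fun t σ hσ => h.expect_bias_le hσ hx₀ (hmono t) (hs1 (t + 1)) (hsucc t) (hs t) hd hdx hν hνn
      hl hj) t
  have hexp : ∀ z, 6 * L ≤ z → Real.exp (-z) ≤ (n ^ 6)⁻¹ := by
    intro z hz
    calc Real.exp (-z) ≤ Real.exp (-((6 : ℕ) * L)) := Real.exp_le_exp.2 (by push_cast; linarith)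
      _ = _ := by rw [Real.exp_neg, Real.exp_nat_mul, hL, Real.exp_log (by linarith)]
  have h1 : Real.exp (-(l * (opinionFraction σ₀ i₀ - (1 + s 0) * opinionFraction σ₀ j))) ≤
      (n ^ 6)⁻¹ := by
    refine hexp _ ?_
    have hy0 := opinionFraction_nonneg σ₀ j
    have hy : s 0 * opinionFraction σ₀ j ≤ d / 2 := by
      calc s 0 * opinionFraction σ₀ j ≤ d / (2 * x₀) * x₀ := by
            refine mul_le_mul hs0 (by linarith) hy0 (by positivity)
        _ = d / 2 := by field_simp
    have : l * (d / 2) ≤ l * (opinionFraction σ₀ i₀ - (1 + s 0) * opinionFraction σ₀ j) :=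
      mul_le_mul_of_nonneg_left (by linarith) hlpos.le
    linarith
  have h2 : Real.exp (-(l * (x₀ / 8))) ≤ (n ^ 6)⁻¹ := by
    refine hexp _ ?_
    have := mul_le_mul_of_nonneg_left hdx hlpos.le
    linarith
  refine key.trans ?_
  rw [one_pow, one_mul]
  calc _ ≤ (n ^ 6)⁻¹ + n * (n ^ 6)⁻¹ := by gcongr
    _ = (n ^ 6)⁻¹ + (n ^ 5)⁻¹ := by field_simp
    _ ≤ (n ^ 5)⁻¹ + (n ^ 5)⁻¹ := by
        gcongr
        norm_num
    _ = _ := by ring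

/-- From the time on at which every rival is half as large as the plurality opinion, the expected
inverse fraction of the latter contracts to `1`. -/
theorem DriftBounds.killedSum_ne_one_le (h : DriftBounds step i₀ x₀ ν) (σ₀ : V → Fin k)
    (hx₀ : 0 < x₀) (hx1 : x₀ ≤ 1) (hn2 : (2 : ℝ) ≤ Fintype.card V) (hν : 0 ≤ ν) (hνx : 32 * ν ≤ x₀)
    (hxn : 2 ≤ x₀ * Fintype.card V) {N : ℕ} (hN : 64 * Real.log (Fintype.card V) ≤ x₀ * N)
    {s : ℕ → ℝ} (hs : ∀ t, N ≤ t → s t = 1) :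
    killedSum step σ₀ (fun t => dominating V i₀ x₀ (s t)) (N + N)
      (fun τ => Fintype.card V * (1 / max (opinionFraction τ i₀) (x₀ / 2) - 1))
      ≤ ((Fintype.card V : ℝ) ^ 2)⁻¹ := by
  set n : ℝ := (Fintype.card V : ℝ) with hnV
  set G := fun t => dominating V i₀ x₀ (s t)
  set f : (V → Fin k) → ℝ := fun τ => 1 / max (opinionFraction τ i₀) (x₀ / 2) - 1 with hf
  have hf0 : ∀ τ, 0 ≤ f τ := by
    intro τ
    have h1 : max (opinionFraction τ i₀) (x₀ / 2) ≤ 1 :=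
      max_le (opinionFraction_le_one τ i₀) (by linarith)
    have h2 : 0 < max (opinionFraction τ i₀) (x₀ / 2) := lt_max_of_lt_right (by linarith)
    simp only [hf]
    rw [sub_nonneg, le_div_iff₀ h2]; linarith
  have hfn : ∀ τ, f τ ≤ n := by
    intro τ
    have h2 : 0 < max (opinionFraction τ i₀) (x₀ / 2) := lt_max_of_lt_right (by linarith)
    have h1 : 1 / max (opinionFraction τ i₀) (x₀ / 2) ≤ n := by
      rw [div_le_iff₀ h2]
      calc 1 ≤ n * (x₀ / 2) := by linarith
        _ ≤ _ := by gcongr; exact le_max_right _ _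
    simp only [hf]; linarith
  have key := killedSum_le_of_contraction step σ₀ G f (r := 1 - x₀ / 16) (by linarith) hf0 N
    (fun t ht σ hσ => h.expect_inverse_le (by simpa only [G, hs t ht] using hσ) hx₀ hν hνx) N
  rw [killedSum_const_mul]
  -- Nothing but the crude bound `f ≤ n` is used at time `N`; the next `N` contractions supply
  -- `n⁻⁴`.
  calc _ ≤ n * ((n ^ 4)⁻¹ * n) := by
        refine mul_le_mul_of_nonneg_left (key.trans ?_) (by linarith)
        refine mul_le_mul (one_sub_pow_le_inv hx1 (by linarith) hN) ?_
          (Finset.sum_nonneg fun s _ => mul_nonneg (killedMass_nonneg ..) (hf0 s)) (by positivity)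
        exact (killedSum_mono _ _ _ _ hfn).trans (killedSum_const_le _ _ _ _ (by linarith))
    _ = _ := by field_simp

/-- Consensus on a plurality opinion whose lead is large with respect to the noise level `ν`. -/
theorem DriftBounds.consensus (h : DriftBounds step i₀ x₀ ν) {σ₀ : V → Fin k}
    (hσ₀ : opinionFraction σ₀ i₀ = x₀) (hk : k ≤ Fintype.card V) (hn2 : 2 ≤ Fintype.card V)
    (hν : 0 < ν) (hνn : 1 ≤ ν * Fintype.card V)
    (hC : 10 ^ 7 * ν * Real.log (Fintype.card V) ^ 2 ≤ x₀)
    (hbias : ∀ j ≠ i₀, √(10 ^ 7 * ν * x₀ * Real.log (Fintype.card V)) ≤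
      opinionFraction σ₀ i₀ - opinionFraction σ₀ j) :
    ∃ T : ℕ, (T : ℝ) ≤ 130 * (Real.log (Fintype.card V) / x₀) ∧
      ∀ (Ω : Type*) [MeasurableSpace Ω] (μ : Measure Ω) [IsProbabilityMeasure μ]
        (X : ℕ → Ω → V → Fin k), IsMarkovChain step σ₀ μ X →
        1 - 10 * (Fintype.card V : ℝ)⁻¹ ≤ μ.real {ω | opinionFraction (X T ω) i₀ = 1} := by
  classical
  have hn2' : (2 : ℝ) ≤ Fintype.card V := by exact_mod_cast hn2
  have hkn : (k : ℝ) ≤ Fintype.card V := by exact_mod_cast hk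
  have hx1 : x₀ ≤ 1 := hσ₀ ▸ opinionFraction_le_one σ₀ i₀
  set n : ℝ := (Fintype.card V : ℝ) with hnV
  set L := Real.log n with hL
  have hnpos : 0 < n := by linarith
  have hCn : 10 ^ 7 * L ^ 2 ≤ x₀ * n := by
    calc 10 ^ 7 * L ^ 2 ≤ 10 ^ 7 * L ^ 2 * (ν * n) := le_mul_of_one_le_right (by positivity) hνn
      _ = 10 ^ 7 * ν * L ^ 2 * n := by ring
      _ ≤ x₀ * n := by gcongr
  -- The hypothesis itself forces `n` to be large: `10^7 L² ≤ n` with `L ≥ log 2` gives `n ≥ 3 > e`.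
  have hL1 : 1 ≤ L := by
    have h1 : Real.log 2 ≤ L := Real.log_le_log (by norm_num) hn2'
    have h2 := Real.log_two_gt_d9
    have h3 : 3 ≤ n := by nlinarith
    rw [hL, Real.le_log_iff_exp_le hnpos]
    linarith [Real.exp_one_lt_d9]
  have hx₀ : 0 < x₀ := lt_of_lt_of_le (by positivity) hC
  have hL2 : L ≤ L ^ 2 := by nlinarith
  set d := √(10 ^ 7 * ν * x₀ * L) with hd
  have hdpos : 0 < d := Real.sqrt_pos.2 (by positivity)
  have hd2 : 10 ^ 7 * ν * x₀ * L = d ^ 2 := (Real.sq_sqrt (by positivity)).symm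
  have hdx : d ≤ x₀ := by
    refine Real.sqrt_le_iff.2 ⟨hx₀.le, ?_⟩
    calc 10 ^ 7 * ν * x₀ * L ≤ 10 ^ 7 * ν * x₀ * L ^ 2 := by gcongr
      _ = 10 ^ 7 * ν * L ^ 2 * x₀ := by ring
      _ ≤ x₀ * x₀ := by gcongr
      _ = x₀ ^ 2 := (sq x₀).symm
  -- Long enough for `(1 + x₀ / 32)^N ≥ n` and `(1 - x₀ / 16)^N ≤ n⁻⁴`. Rounding up twice costs 2,
  -- at most `2 L / x₀`, hence 130 in place of 128.
  set N := ⌈64 * L / x₀⌉₊ with hNdef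
  have hN : 64 * L ≤ x₀ * N := by
    have := Nat.le_ceil (64 * L / x₀)
    rw [div_le_iff₀ hx₀] at this
    linarith
  have hN' : ((N + N : ℕ) : ℝ) * x₀ ≤ 130 * L := by
    have := (Nat.ceil_lt_add_one (by positivity : 0 ≤ 64 * L / x₀)).le
    have h2 := mul_le_mul_of_nonneg_right this hx₀.le
    rw [add_mul, div_mul_cancel₀ _ hx₀.ne'] at h2
    push_cast
    linarith
  have hTn : ((N + N : ℕ) : ℝ) ≤ n := by
    have h1 : ((N + N : ℕ) : ℝ) * x₀ ≤ n * x₀ := by linarith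
    exact le_of_mul_le_mul_right h1 hx₀
  -- This initial ratio spends at most half of the lead `d`. It is at least `1 / n`, so growth by a
  -- factor `n` brings it to 1.
  set s₀ := d / (2 * x₀) with hs₀
  have hs₀pos : 0 < s₀ := by positivity
  have hs₀1 : s₀ ≤ 1 := by rw [hs₀, div_le_one (by positivity)]; linarith
  have hs₀n : 1 ≤ s₀ * n := by
    rw [hs₀, div_mul_eq_mul_div, one_le_div (by positivity)]
    refine le_of_sq_le_sq ?_ (by positivity)
    rw [mul_pow, mul_pow, ← hd2]
    have h1 : 4 * x₀ ≤ 10 ^ 7 * (ν * n) * L * n := by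
      have : 1 ≤ (ν * n) * L := one_le_mul_of_one_le_of_one_le hνn hL1
      nlinarith
    nlinarith
  set s : ℕ → ℝ := fun t => min 1 (s₀ * (1 + x₀ / 32) ^ t) with hs
  have hspow : ∀ t : ℕ, s₀ ≤ s₀ * (1 + x₀ / 32) ^ t := fun t =>
    le_mul_of_one_le_right hs₀pos.le (one_le_pow₀ (by linarith))
  have hs_ge : ∀ t, s₀ ≤ s t := fun t => le_min hs₀1 (hspow t)
  have hs_le : ∀ t, s t ≤ 1 := fun t => min_le_left _ _
  have hs_mono : ∀ t, s t ≤ s (t + 1) := fun t =>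
    min_le_min le_rfl (mul_le_mul_of_nonneg_left
      (pow_le_pow_right₀ (by linarith) (Nat.le_succ t)) hs₀pos.le)
  have hs_succ : ∀ t, s (t + 1) ≤ (1 + x₀ / 32) * s t := by
    intro t
    simp only [hs]
    rw [mul_min_of_nonneg _ _ (by linarith)]
    refine min_le_min (by linarith) (le_of_eq (by ring))
  have hs_one : ∀ t, N ≤ t → s t = 1 := fun t ht => min_eq_left <|
    hs₀n.trans (mul_le_mul_of_nonneg_left (inv_le_one_add_pow hx₀ hx1 hnpos hN ht) hs₀pos.le)
  set G := fun t => dominating V i₀ x₀ (s t) with hG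
  have hbad : ∀ t ∈ Finset.range (N + N),
      killedSum step σ₀ G t (fun τ => if τ ∈ G t then 0 else 1) ≤ 4 * (n ^ 4)⁻¹ := by
    intro t ht
    have htT : (t : ℝ) ≤ ((N + N : ℕ) : ℝ) := by
      exact_mod_cast (Finset.mem_range.1 ht).le
    have htn : (t : ℝ) ≤ n := htT.trans hTn
    have hA := h.killedSum_plurality_le hσ₀ hx₀ hν hνn hL1 hC (fun t => hs₀pos.le.trans (hs_ge t))
      (t := t) (le_trans (by gcongr) hN') htn
    have hB := fun j hj => h.killedSum_bias_le hσ₀ hx₀ hν hνn hdpos hdx hd2 (j := j) hj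
      (hbias j hj) (by simp [hs, hs₀]) hs_ge hs_mono hs_le hs_succ htn
    -- Outside the good set at least one of these exponentials is at least 1. The union over at most
    -- `k ≤ n` rivals costs one factor `n`.
    calc _ ≤ killedSum step σ₀ G t fun τ =>
          Real.exp (-(16 * L / x₀ * (opinionFraction τ i₀ - x₀ / 2))) +
          ∑ j ∈ Finset.univ.erase i₀, Real.exp (-(d / (1280 * ν * x₀) *
            (opinionFraction τ i₀ - (1 + s t) * opinionFraction τ j))) := by
          refine killedSum_mono _ _ _ _ fun τ => ?_
          split_ifs with hτ
          · exact add_nonneg (Real.exp_nonneg _) (Finset.sum_nonneg fun _ _ => Real.exp_nonneg _)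
          · by_cases h1 : x₀ / 2 ≤ opinionFraction τ i₀
            · obtain ⟨j, hj, hlt⟩ : ∃ j, j ≠ i₀ ∧
                  opinionFraction τ i₀ < (1 + s t) * opinionFraction τ j := by
                by_contra! hcon
                exact hτ ⟨h1, hcon⟩
              refine le_add_of_nonneg_of_le (Real.exp_nonneg _) ?_
              refine le_trans ?_ (Finset.single_le_sum (fun _ _ => Real.exp_nonneg _)
                (Finset.mem_erase.2 ⟨hj, Finset.mem_univ j⟩))
              refine Real.one_le_exp (neg_nonneg.2 (mul_nonpos_of_nonneg_of_nonpos ?_ ?_))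
              · positivity
              · linarith
            · refine le_add_of_le_of_nonneg ?_ (Finset.sum_nonneg fun _ _ => Real.exp_nonneg _)
              refine Real.one_le_exp (neg_nonneg.2 (mul_nonpos_of_nonneg_of_nonpos ?_ ?_))
              · positivity
              · linarith
      _ ≤ 2 * (n ^ 6)⁻¹ + ∑ j ∈ Finset.univ.erase i₀, 2 * (n ^ 5)⁻¹ := by
          rw [killedSum_add, killedSum_sum]
          exact add_le_add hA (Finset.sum_le_sum fun j hj => hB j (Finset.ne_of_mem_erase hj))
      _ ≤ 2 * (n ^ 6)⁻¹ + n * (2 * (n ^ 5)⁻¹) := by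
          rw [Finset.sum_const, nsmul_eq_mul]
          gcongr
          refine le_trans ?_ hkn
          exact_mod_cast (Finset.card_le_univ _).trans_eq (Fintype.card_fin k)
      _ = 2 * (n ^ 6)⁻¹ + 2 * (n ^ 4)⁻¹ := by field_simp
      _ ≤ 2 * (n ^ 4)⁻¹ + 2 * (n ^ 4)⁻¹ := by
          gcongr
          · linarith
          · norm_num
      _ = _ := by ring
  have hend := h.killedSum_ne_one_le σ₀ hx₀ hx1 hn2' hν.le
    (by nlinarith) (by nlinarith) hN hs_one
  refine ⟨N + N, ?_, fun Ω _ μ _ X hX => ?_⟩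
  · rw [← mul_div_assoc, le_div_iff₀ hx₀]; exact hN'
  have hmain := hX.one_sub_le (G := G) (N + N) {τ | opinionFraction τ i₀ = 1}
  have hlast : killedSum step σ₀ G (N + N)
      (fun τ => if τ ∈ {τ : V → Fin k | opinionFraction τ i₀ = 1} then 0 else 1) ≤ (n ^ 2)⁻¹ := by
    refine (killedSum_mono _ _ _ _ fun τ => ?_).trans hend
    have h2 : 0 < max (opinionFraction τ i₀) (x₀ / 2) := lt_max_of_lt_right (by linarith)
    split_ifs with hτ
    · have h1 : max (opinionFraction τ i₀) (x₀ / 2) ≤ 1 :=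
        max_le (opinionFraction_le_one τ i₀) (by linarith)
      refine mul_nonneg hnpos.le ?_
      rw [sub_nonneg, le_div_iff₀ h2]; linarith
    -- With `n ≥ 2` the truncation level `x₀ / 2` is also at most `1 - 1 / n`, so the test function
    -- is at least 1 at every state short of consensus.
    · have h3 : 1 / n ≤ 1 / 2 := by gcongr
      have h1 : max (opinionFraction τ i₀) (x₀ / 2) ≤ 1 - 1 / n :=
        max_le (opinionFraction_le_of_ne_one hτ) (by linarith)
      have h4 : 1 + 1 / n ≤ 1 / max (opinionFraction τ i₀) (x₀ / 2) := by
        rw [le_div_iff₀ h2]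
        calc (1 + 1 / n) * max (opinionFraction τ i₀) (x₀ / 2) ≤ (1 + 1 / n) * (1 - 1 / n) := by
              gcongr
          _ ≤ 1 := by nlinarith [sq_nonneg (1 / n)]
      calc 1 = n * (1 / n) := by field_simp
        _ ≤ _ := by gcongr; linarith
  have hsum := Finset.sum_le_sum hbad
  rw [Finset.sum_const, Finset.card_range, nsmul_eq_mul] at hsum
  have hsum' : ((N + N : ℕ) : ℝ) * (4 * (n ^ 4)⁻¹) ≤ 4 * n⁻¹ := by
    calc ((N + N : ℕ) : ℝ) * (4 * (n ^ 4)⁻¹) ≤ n * (4 * (n ^ 4)⁻¹) := by gcongr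
      _ = 4 * (n ^ 3)⁻¹ := by field_simp
      _ ≤ 4 * n⁻¹ := by
        gcongr
        exact le_self_pow₀ (by linarith) (by norm_num)
  have hsq : (n ^ 2)⁻¹ ≤ n⁻¹ := by
    gcongr
    exact le_self_pow₀ (by linarith) (by norm_num)
  have hinv : 0 ≤ n⁻¹ := by positivity
  refine le_trans ?_ hmain
  linarith

end Consensus

/-! ### Specialization to 3-Majority and 2-Choices. -/

section Main

variable {V : Type*} [Fintype V] [DecidableEq V] [Nonempty V] {k : ℕ}

omit [DecidableEq V] in
theorem opinionNormSq_le_of_lead {σ : V → Fin k} {i₀ : Fin k}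
    (h : ∀ j ≠ i₀, 0 ≤ opinionFraction σ i₀ - opinionFraction σ j) :
    opinionNormSq σ ≤ opinionFraction σ i₀ := by
  refine opinionNormSq_le_of_plurality fun j => ?_
  by_cases hj : j = i₀
  · rw [hj]
  · linarith [h j hj]

omit [DecidableEq V] in
/-- With a single opinion there is nothing to wait for. -/
theorem consensus_at_zero (step : (V → Fin k) → PMF (V → Fin k)) (hk : k ≤ 1) (σ₀ : V → Fin k)
    (i₀ : Fin k) {b : ℝ} (hb : 0 ≤ b) :
    ∃ T : ℕ, (T : ℝ) ≤ b ∧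
      ∀ (Ω : Type*) [MeasurableSpace Ω] (μ : Measure Ω) [IsProbabilityMeasure μ]
        (X : ℕ → Ω → V → Fin k), IsMarkovChain step σ₀ μ X →
        1 - 10 * (Fintype.card V : ℝ) ^ (-1 : ℝ) ≤
          μ.real {ω | opinionFraction (X T ω) i₀ = 1} := by
  refine ⟨0, by simpa using hb, fun Ω _ μ _ X _ => ?_⟩
  have hsub : Subsingleton (Fin k) := Fin.subsingleton_iff_le_one.2 hk
  have h1 : ∀ τ : V → Fin k, opinionFraction τ i₀ = 1 := by
    intro τ
    rw [← sum_opinionFraction τ, Fintype.sum_subsingleton _ i₀]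
  have : (0 : ℝ) ≤ 10 * (Fintype.card V : ℝ) ^ (-1 : ℝ) := by positivity
  simp only [h1, Set.ofPred_true, probReal_univ]
  linarith

theorem DriftBounds.exists_time {step : (V → Fin k) → PMF (V → Fin k)} {i₀ : Fin k} {x₀ ν : ℝ}
    (h : DriftBounds step i₀ x₀ ν) {σ₀ : V → Fin k}
    (hσ₀ : opinionFraction σ₀ i₀ = x₀) (hk : k ≤ Fintype.card V) (hn2 : 2 ≤ Fintype.card V)
    (hν : 0 < ν) (hνn : 1 ≤ ν * Fintype.card V)
    (hC : 10 ^ 7 * ν * Real.log (Fintype.card V) ^ 2 ≤ x₀)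
    (hbias : ∀ j ≠ i₀, √(10 ^ 7 * ν * x₀ * Real.log (Fintype.card V)) ≤
      opinionFraction σ₀ i₀ - opinionFraction σ₀ j)
    (hγ : opinionNormSq σ₀ ≤ x₀) :
    ∃ T : ℕ, (T : ℝ) ≤ 130 * (Real.log (Fintype.card V) / opinionNormSq σ₀) ∧
      ∀ (Ω : Type*) [MeasurableSpace Ω] (μ : Measure Ω) [IsProbabilityMeasure μ]
        (X : ℕ → Ω → V → Fin k), IsMarkovChain step σ₀ μ X →
        1 - 10 * (Fintype.card V : ℝ) ^ (-1 : ℝ) ≤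
          μ.real {ω | opinionFraction (X T ω) i₀ = 1} := by
  obtain ⟨T, hT, hcons⟩ := h.consensus hσ₀ hk hn2 hν hνn hC hbias
  refine ⟨T, hT.trans ?_, fun Ω _ μ _ X hX => ?_⟩
  · have := opinionNormSq_pos σ₀
    have := Real.log_natCast_nonneg (Fintype.card V)
    gcongr
  · rw [Real.rpow_neg_one]; exact hcons Ω μ X hX

end Main

/-- Opinion `1` of the opinions `1, …, k` is the element `⟨0, hk⟩` of `Fin k`. -/
theorem theorem4 :
    (∃ C₀ A K c : ℝ, 0 < C₀ ∧ 0 < A ∧ 0 < K ∧ 0 < c ∧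
      ∀ C : ℝ, C₀ ≤ C →
      ∀ (n k : ℕ) (hk : 1 ≤ k), k ≤ n →
      ∀ (V : Type*) [Fintype V] [DecidableEq V] [Nonempty V], Fintype.card V = n →
      ∀ σ₀ : V → Fin k,
        C * Real.log n / Real.sqrt n ≤ opinionNormSq σ₀ →
        (∀ j : Fin k, j ≠ ⟨0, hk⟩ →
          C * Real.sqrt (Real.log n / n)
            ≤ opinionFraction σ₀ ⟨0, hk⟩ - opinionFraction σ₀ j) →
        ∃ T : ℕ, (T : ℝ) ≤ A * (Real.log n / opinionNormSq σ₀) ∧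
          ∀ (Ω : Type*) [MeasurableSpace Ω] (μ : Measure Ω) [IsProbabilityMeasure μ]
            (opn : ℕ → Ω → V → Fin k),
            IsMarkovChain threeMajorityStep σ₀ μ opn →
            1 - K * (n : ℝ) ^ (-c) ≤ μ.real {ω | opinionFraction (opn T ω) ⟨0, hk⟩ = 1}) ∧
    (∃ C₀ A K c : ℝ, 0 < C₀ ∧ 0 < A ∧ 0 < K ∧ 0 < c ∧
      ∀ C : ℝ, C₀ ≤ C →
      ∀ (n k : ℕ) (hk : 1 ≤ k), k ≤ n →
      ∀ (V : Type*) [Fintype V] [DecidableEq V] [Nonempty V], Fintype.card V = n →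
      ∀ σ₀ : V → Fin k,
        C * Real.log n ^ 2 / n ≤ opinionNormSq σ₀ →
        (∀ j : Fin k, j ≠ ⟨0, hk⟩ →
          C * Real.sqrt (opinionFraction σ₀ ⟨0, hk⟩ * Real.log n / n)
            ≤ opinionFraction σ₀ ⟨0, hk⟩ - opinionFraction σ₀ j) →
        ∃ T : ℕ, (T : ℝ) ≤ A * (Real.log n / opinionNormSq σ₀) ∧
          ∀ (Ω : Type*) [MeasurableSpace Ω] (μ : Measure Ω) [IsProbabilityMeasure μ]
            (opn : ℕ → Ω → V → Fin k),
            IsMarkovChain twoChoicesStep σ₀ μ opn →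
            1 - K * (n : ℝ) ^ (-c) ≤ μ.real {ω | opinionFraction (opn T ω) ⟨0, hk⟩ = 1}) := by
  constructor
  · refine ⟨10 ^ 7, 130, 10, 1, by norm_num, by norm_num, by norm_num, by norm_num, ?_⟩
    intro C hC n k hk hkn V _ _ _ hn σ₀ hγ hbias
    subst hn
    -- For `n = 1` the logarithm vanishes, so `T = 0` is forced; `k ≤ n` leaves a single opinion.
    rcases Nat.lt_or_ge (Fintype.card V) 2 with hn1 | hn2
    · exact consensus_at_zero threeMajorityStep (by omega) σ₀ _
        (mul_nonneg (by norm_num) (div_nonneg (Real.log_natCast_nonneg _) (opinionNormSq_nonneg _)))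
    have hn : (0 : ℝ) < Fintype.card V := by exact_mod_cast Fintype.card_pos
    have hl : 0 ≤ Real.log (Fintype.card V) := Real.log_natCast_nonneg _
    have hC0 : 0 < C := lt_of_lt_of_le (by norm_num) hC
    have hγx := opinionNormSq_le_of_lead (i₀ := ⟨0, hk⟩) fun j hj =>
      le_trans (by positivity) (hbias j hj)
    have hx₀ := (opinionNormSq_pos σ₀).trans_le hγx
    set x₀ := opinionFraction σ₀ ⟨0, hk⟩ with hx
    -- Since `γ₀ ≤ x₀`, the norm hypothesis bounds `x₀² n` from below, which is what `ν L² ≤ x₀ /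
    -- 10^7` requires when `ν` itself contains `1 / x₀`.
    have hlx : (10 ^ 7 * Real.log (Fintype.card V)) ^ 2 ≤ x₀ ^ 2 * Fintype.card V := by
      have h1 : 10 ^ 7 * Real.log (Fintype.card V) ≤ x₀ * √(Fintype.card V : ℝ) := by
        rw [div_le_iff₀ (Real.sqrt_pos.2 hn)] at hγ
        calc 10 ^ 7 * Real.log (Fintype.card V) ≤ C * Real.log (Fintype.card V) := by gcongr
          _ ≤ _ := hγ
          _ ≤ _ := by gcongr
      calc _ ≤ (x₀ * √(Fintype.card V : ℝ)) ^ 2 := by gcongr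
        _ = _ := by rw [mul_pow, Real.sq_sqrt hn.le]
    refine (driftBounds_threeMajorityStep ⟨0, hk⟩ hx₀).exists_time hx.symm hkn hn2
      (by positivity) ?_ ?_ ?_ hγx
    · have : 2 / (Fintype.card V * x₀) * Fintype.card V = 2 / x₀ := by field_simp
      rw [this, one_le_div hx₀]
      linarith [opinionFraction_le_one σ₀ ⟨0, hk⟩]
    · have e : 10 ^ 7 * (2 / (Fintype.card V * x₀)) * Real.log (Fintype.card V) ^ 2 =
          2 * 10 ^ 7 * Real.log (Fintype.card V) ^ 2 / (Fintype.card V * x₀) := by ring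
      rw [e, div_le_iff₀ (by positivity)]
      nlinarith [sq_nonneg (Real.log (Fintype.card V))]
    · intro j hj
      refine le_trans ?_ (hbias j hj)
      -- The `x₀` in `ν` cancels, which is why the lead required of 3-Majority does not involve
      -- `α₀(1)`.
      have e : 10 ^ 7 * (2 / (Fintype.card V * x₀)) * x₀ * Real.log (Fintype.card V) =
          2 * 10 ^ 7 * (Real.log (Fintype.card V) / Fintype.card V) := by field_simp
      rw [e]
      refine Real.sqrt_le_iff.2 ⟨by positivity, ?_⟩
      rw [mul_pow, Real.sq_sqrt (by positivity)]
      gcongr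
      nlinarith
  · refine ⟨10 ^ 7, 130, 10, 1, by norm_num, by norm_num, by norm_num, by norm_num, ?_⟩
    intro C hC n k hk hkn V _ _ _ hn σ₀ hγ hbias
    subst hn
    rcases Nat.lt_or_ge (Fintype.card V) 2 with hn1 | hn2
    · exact consensus_at_zero twoChoicesStep (by omega) σ₀ _
        (mul_nonneg (by norm_num) (div_nonneg (Real.log_natCast_nonneg _) (opinionNormSq_nonneg _)))
    have hn : (0 : ℝ) < Fintype.card V := by exact_mod_cast Fintype.card_pos
    have hl : 0 ≤ Real.log (Fintype.card V) := Real.log_natCast_nonneg _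
    have hC0 : 0 < C := lt_of_lt_of_le (by norm_num) hC
    have hγx := opinionNormSq_le_of_lead (i₀ := ⟨0, hk⟩) fun j hj =>
      le_trans (by positivity) (hbias j hj)
    have hx₀ := (opinionNormSq_pos σ₀).trans_le hγx
    set x₀ := opinionFraction σ₀ ⟨0, hk⟩ with hx
    refine (driftBounds_twoChoicesStep ⟨0, hk⟩ x₀).exists_time hx.symm hkn hn2
      (by positivity) ?_ ?_ ?_ hγx
    · rw [one_div, inv_mul_cancel₀ hn.ne']
    · refine le_trans ?_ (hγ.trans hγx)
      rw [mul_one_div, div_mul_eq_mul_div]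
      gcongr
    · intro j hj
      refine le_trans ?_ (hbias j hj)
      have e : 10 ^ 7 * (1 / (Fintype.card V : ℝ)) * x₀ * Real.log (Fintype.card V) =
          10 ^ 7 * (x₀ * Real.log (Fintype.card V) / Fintype.card V) := by field_simp
      rw [e]
      refine Real.sqrt_le_iff.2 ⟨by positivity, ?_⟩
      rw [mul_pow, Real.sq_sqrt (by positivity)]
      gcongr
      nlinarith
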